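/- An overpartition of $n$ is a partition of $n$ in which the first occurrence of each part size may be overlined. For an overpartition $\pi$ let $l(\pi)$ be its largest part ($0$ if $\pi$ is empty), $\#(\pi)$ its number of parts, $\#(\pi_o)$ the number of its odd non-overlined parts, and $\chi(\pi)=1$ if the largest part of $\pi$ (in its first occurrence) is odd and non-overlined, $\chi(\pi)=0$ otherwise. The $M_2$-rank of $\pi$ is $\lceil l(\pi)/2\rceil-\#(\pi)+\#(\pi_o)-\chi(\pi)$. Let $\overline{N2}(m,n)$ be the number of overpartitions of $n$ with $M_2$-rank $m$. Write $(a;q)_\infty=\prod_{j\ge 0}(1-aq^j)$, and define $\overline{M2}(m,n)$, for $m\in\mathbb{Z}$ and $n\ge 0$, by the identity of formal power series in $q$ whose coefficients are Laurent polynomials in $z$ $$\sum_{n=0}^\infty\sum_{m=-\infty}^\infty \overline{M2}(m,n)z^mq^n=\frac{(-q;q)_\infty(q^2;q^2)_\infty}{(q;q^2)_\infty(zq^2;q^2)_\infty(z^{-1}q^2;q^2)_\infty}.$$ For $j\ge 1$ define the symmetrized moments (finite sums) $$\overline{\eta 2}_j(n)=\sum_{m\in\mathbb{Z}}\binom{m+\lfloor\frac{j-1}{2}\rfloor}{j}\overline{N2}(m,n),\qquad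 \overline{\mu 2}_j(n)=\sum_{m\in\mathbb{Z}}\binom{m+\lfloor\frac{j-1}{2}\rfloor}{j}\overline{M2}(m,n),$$ where $\binom{x}{j}=x(x-1)\cdots(x-j+1)/j!$ for every integer $x$, and put $\overline{\mathrm{spt}2}_k(n)=\overline{\mu 2}_{2k}(n)-\overline{\eta 2}_{2k}(n)$. Then for all $k\ge 1$, as formal power series in $q$, $$\sum_{n=1}^\infty \overline{\mathrm{spt}2}_k(n)q^n=\sum_{n=1}^\infty\bigl(\overline{\mu 2}_{2k}(n)-\overline{\eta 2}_{2k}(n)\bigr)q^n=\sum_{n_k\ge n_{k-1}\ge\cdots\ge n_1\ge 1}\frac{q^{2n_1+2n_2+\cdots+2n_k}}{(1-q^{2n_k})^2(1-q^{2n_{k-1}})^2\cdots(1-q^{2n_1})^2}\cdot\frac{(-q^{2n_1+1};q)_\infty}{(q^{2n_1+1};q)_\infty},$$ where the sum over $(n_1,\dots,n_k)$ converges coefficientwise. Consequently $\overline{\mathrm{spt}2}_k(n)\ge 0$ for all $k\ge 1$ and $n\ge 1$. -/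

import Mathlib

open scoped PowerSeries LaurentPolynomial PowerSeries.WithPiTopology

noncomputable section

namespace SptBar

/-! ### Formal `q`-series; the variable `q` is `PowerSeries.X`. -/

/-- The finite product `(a; q^b)_n = ∏_{j < n} (1 - a q^{b j})`. -/
def qPoch {R : Type*} [CommRing R] (a : R⟦X⟧) (b n : ℕ) : R⟦X⟧ :=
  ∏ j ∈ Finset.range n, (1 - a * PowerSeries.X ^ (b * j))

/-- The infinite product `(a; q^b)_∞` for `b ≥ 1`, as a formal power series: its coefficient at
`q^n` is that of the partial product `(a; q^b)_{n+1}`, and equally that of every later partial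
product, see `coeff_qPochInf`. -/
def qPochInf {R : Type*} [CommRing R] (a : R⟦X⟧) (b : ℕ) : R⟦X⟧ :=
  PowerSeries.mk fun n => PowerSeries.coeff n (qPoch a b (n + 1))

theorem coeff_qPochInf {R : Type*} [CommRing R] (a : R⟦X⟧) {b : ℕ} (hb : 1 ≤ b) {n N : ℕ}
    (h : n < N) :
    PowerSeries.coeff n (qPochInf a b) = PowerSeries.coeff n (qPoch a b N) := by
  rw [qPochInf, PowerSeries.coeff_mk]
  induction N, h using Nat.le_induction with
  | base => rfl
  | succ N hN ih =>
    have hlt : n < b * N := lt_of_lt_of_le (Nat.lt_of_succ_le hN) (Nat.le_mul_of_pos_left N hb)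
    rw [ih]
    conv_rhs => rw [qPoch, Finset.prod_range_succ, ← qPoch, mul_sub, mul_one, ← mul_assoc,
      map_sub, PowerSeries.coeff_mul_X_pow', if_neg (not_le.mpr hlt), sub_zero]

theorem constantCoeff_qPochInf {R : Type*} [CommRing R] (a : R⟦X⟧) (b : ℕ)
    (ha : PowerSeries.constantCoeff a = 0) :
    PowerSeries.constantCoeff (qPochInf a b) = 1 := by
  rw [← PowerSeries.coeff_zero_eq_constantCoeff_apply, qPochInf, PowerSeries.coeff_mk]
  simp [qPoch, ha]

/-- The multiplicative inverse of a power series with constant coefficient `1`. -/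
def qInv {R : Type*} [CommRing R] (f : R⟦X⟧) : R⟦X⟧ := PowerSeries.invOfUnit f 1

theorem mul_qInv {R : Type*} [CommRing R] (f : R⟦X⟧) (h : PowerSeries.constantCoeff f = 1) :
    f * qInv f = 1 :=
  PowerSeries.mul_invOfUnit f 1 (by simpa using h)

/-! ### Overpartitions and the `M₂`-rank -/

/-- An overpartition of `n`: a partition of `n` together with the set of those part sizes whose
first occurrence is overlined. -/
structure Overpartition (n : ℕ) where
  toPartition : n.Partition
  overlined : Finset ℕ
  overlined_subset : overlined ⊆ toPartition.parts.toFinset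

instance (n : ℕ) : Finite (Overpartition n) := by
  let f : Overpartition n → Σ p : n.Partition, {S : Finset ℕ // S ∈ p.parts.toFinset.powerset} :=
    fun π => ⟨π.toPartition, π.overlined, Finset.mem_powerset.mpr π.overlined_subset⟩
  refine Finite.of_injective f ?_
  rintro ⟨p, S, hS⟩ ⟨p', S', hS'⟩ h
  simp only [f, Sigma.mk.injEq] at h
  obtain ⟨rfl, h⟩ := h
  simpa using h

namespace Overpartition

/-- The largest part (`0` for the empty overpartition). -/
def largest {n : ℕ} (π : Overpartition n) : ℕ := π.toPartition.parts.sup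

/-- The number of parts. -/
def numParts {n : ℕ} (π : Overpartition n) : ℕ := π.toPartition.parts.card

/-- The non-overlined parts: one copy of each overlined part is removed. -/
def nonOverlined {n : ℕ} (π : Overpartition n) : Multiset ℕ :=
  π.toPartition.parts - π.overlined.val

/-- The number of odd non-overlined parts. -/
def numOddNonOverlined {n : ℕ} (π : Overpartition n) : ℕ :=
  π.nonOverlined.countP (fun i => Odd i)

/-- `1` if the largest part (in its first occurrence) is odd and non-overlined, else `0`. -/
def chi {n : ℕ} (π : Overpartition n) : ℕ :=
  if Odd π.largest ∧ π.largest ∉ π.overlined then 1 else 0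

/-- The `M₂`-rank `⌈l(π)/2⌉ - #(π) + #(π_o) - χ(π)`. -/
def m2Rank {n : ℕ} (π : Overpartition n) : ℤ :=
  ⌈(π.largest : ℚ) / 2⌉ - (π.numParts : ℤ) + (π.numOddNonOverlined : ℤ) - (π.chi : ℤ)

end Overpartition

/-- The number of overpartitions of `n` with `M₂`-rank `m`. -/
def N2bar (m : ℤ) (n : ℕ) : ℕ := Nat.card {π : Overpartition n // π.m2Rank = m}

/-! ### The second residual crank -/

/-- The two-variable series
`(-q;q)_∞ (q²;q²)_∞ / ((q;q²)_∞ (z q²;q²)_∞ (z⁻¹ q²;q²)_∞)`,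
a power series in `q` whose coefficients are Laurent polynomials in `z = T 1`. -/
def crankGF : ℤ[T;T⁻¹]⟦X⟧ :=
  qPochInf (-PowerSeries.X) 1 * qPochInf (PowerSeries.X ^ 2) 2 *
    qInv (qPochInf PowerSeries.X 2 *
      qPochInf (PowerSeries.C (LaurentPolynomial.T 1) * PowerSeries.X ^ 2) 2 *
      qPochInf (PowerSeries.C (LaurentPolynomial.T (-1)) * PowerSeries.X ^ 2) 2)

/-- The coefficient of `z^m q^n` in `crankGF`. -/
def M2bar (m : ℤ) (n : ℕ) : ℤ := (PowerSeries.coeff n crankGF).coeff m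

/-! ### Symmetrized moments -/

/-- `η̄2_k(n) = ∑_m binom(m + ⌊(k-1)/2⌋, k) N̄2(m,n)`, a sum with finitely many nonzero terms;
the binomial coefficient is `x(x-1)⋯(x-k+1)/k!` for every integer `x`. -/
def eta2bar (k n : ℕ) : ℤ :=
  ∑ᶠ m : ℤ, Ring.choose (m + ⌊((k : ℚ) - 1) / 2⌋) k * (N2bar m n : ℤ)

/-- `μ̄2_k(n) = ∑_m binom(m + ⌊(k-1)/2⌋, k) M̄2(m,n)`. -/
def mu2bar (k n : ℕ) : ℤ :=
  ∑ᶠ m : ℤ, Ring.choose (m + ⌊((k : ℚ) - 1) / 2⌋) k * M2bar m n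

theorem finite_support_N2bar (n : ℕ) : (Function.support fun m : ℤ => N2bar m n).Finite := by
  refine (Set.finite_range (fun π : Overpartition n => π.m2Rank)).subset fun m hm => ?_
  by_contra h
  refine hm ?_
  have : IsEmpty {π : Overpartition n // π.m2Rank = m} := ⟨fun π => h ⟨π.1, π.2⟩⟩
  simp [N2bar]

theorem finite_support_M2bar (n : ℕ) : (Function.support fun m : ℤ => M2bar m n).Finite :=
  (PowerSeries.coeff n crankGF).coeff.hasFiniteSupport

/-- The higher order smallest parts function `μ̄2_{2k}(n) - η̄2_{2k}(n)`. -/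
def sptBarTwo (k n : ℕ) : ℤ := mu2bar (2 * k) n - eta2bar (2 * k) n

/-- The `q`-series summand at `n_1 ≤ n_2 ≤ ⋯ ≤ n_k` (where `n_{i+1}` is `v i`):
`q^{2(n_1+⋯+n_k)} / ((1-q^{2n_k})² ⋯ (1-q^{2n_1})²) * (-q^{2n_1+1};q)_∞ / (q^{2n_1+1};q)_∞`. -/
def summand (k : ℕ) (hk : 1 ≤ k) (v : Fin k → ℕ) : ℤ⟦X⟧ :=
  PowerSeries.X ^ (2 * ∑ i, v i) * qInv (∏ i, (1 - PowerSeries.X ^ (2 * v i)) ^ 2) *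
    (qPochInf (-PowerSeries.X ^ (2 * v ⟨0, hk⟩ + 1)) 1 *
      qInv (qPochInf (PowerSeries.X ^ (2 * v ⟨0, hk⟩ + 1)) 1))

end SptBar

end

/-! Write w = z⁻¹. The proof expresses the rank series as the crank series times one
q-hypergeometric sum, and then reads symmetrized moments off that sum.

Rank side: `m2Rank` is `halfLargest` minus `numMarked`, and `halfLargest ≤ N` says exactly that
overlined parts are at most 2N and all parts at most 2N+1. Overpartitions restricted in this way
have the product generating function `boundedGF`, so Abel summation in N gives the rank series as
(1-z) ∑ z^N `boundedGF` N. The sums `kSum` satisfy a two-term recurrence in M (`kSum_sub`). After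
multiplication by `tailFactor` its iteration produces the same series with, to order q^M, the same
remainder. Hence (`rankGF_eq`) the rank series equals the crank series times ∑ (z, w, q; q²)_n
q^{2n} / (q², -q, -q²; q²)_n.

Difference: the term n = 0 is the crank series itself. Every term with n ≥ 1 contains (1-z)(1-w) =
-(z-2+w), and the rest of it is `overlineFactor` · `crankFactor` · `crankTail` at n
(`tailFactor_zero_mul_kTerm`).

Moments: z^m ↦ binom(m+k-1, 2k) is a functional for which multiplication by z-2+w, a second central
difference, lowers k by one. Consecutive values of `crankTail` differ by (z-2+w) · `crankFactor` ·
`crankTail`, so each lowering of k produces one more nested summation index. This gives the multiple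
sum, whose summands visibly have nonnegative coefficients. -/

noncomputable section

namespace SptBar

open PowerSeries Finset

section Tools

variable {R : Type*} [CommRing R]

/-! ### Finite and infinite `q`-products -/

@[simp] theorem qPoch_zero (a : R⟦X⟧) (b : ℕ) : qPoch a b 0 = 1 := by simp [qPoch]

theorem qPoch_succ (a : R⟦X⟧) (b n : ℕ) :
    qPoch a b (n + 1) = qPoch a b n * (1 - a * X ^ (b * n)) := by
  rw [qPoch, prod_range_succ, ← qPoch]

theorem qPoch_succ_left (a : R⟦X⟧) (b n : ℕ) :
    qPoch a b (n + 1) = (1 - a) * qPoch (a * X ^ b) b n := by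
  rw [qPoch, prod_range_succ', mul_comm]
  simp only [qPoch, mul_zero, pow_zero, mul_one, mul_assoc, ← pow_add, mul_add, add_comm]

theorem qPoch_even (a : R⟦X⟧) (n : ℕ) :
    qPoch a 1 (2 * n) = qPoch a 2 n * qPoch (a * X) 2 n := by
  induction n with
  | zero => simp
  | succ n ih =>
    rw [show 2 * (n + 1) = 2 * n + 1 + 1 by ring, qPoch_succ, qPoch_succ, ih, qPoch_succ,
      qPoch_succ]
    ring

theorem constantCoeff_qPoch (a : R⟦X⟧) (b n : ℕ) (ha : constantCoeff a = 0) :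
    constantCoeff (qPoch a b n) = 1 := by
  simp [qPoch, ha, map_prod]

/-! ### Agreement of power series up to a given order -/

/-- The coefficients of `f` and `g` at `X ^ m` agree for `m < N`. -/
def AgreeBelow (N : ℕ) (f g : R⟦X⟧) : Prop := ∀ m < N, coeff m f = coeff m g

namespace AgreeBelow

variable {N M : ℕ} {f g h f' g' : R⟦X⟧}

@[refl] theorem refl (f : R⟦X⟧) : AgreeBelow N f f := fun _ _ => rfl

theorem symm (hfg : AgreeBelow N f g) : AgreeBelow N g f := fun m hm => (hfg m hm).symm

theorem trans (h₁ : AgreeBelow N f g) (h₂ : AgreeBelow N g h) : AgreeBelow N f h :=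
  fun m hm => (h₁ m hm).trans (h₂ m hm)

theorem mono (hfg : AgreeBelow N f g) (hMN : M ≤ N) : AgreeBelow M f g :=
  fun m hm => hfg m (hm.trans_le hMN)

theorem add (h₁ : AgreeBelow N f g) (h₂ : AgreeBelow N f' g') :
    AgreeBelow N (f + f') (g + g') := fun m hm => by simp [h₁ m hm, h₂ m hm]

theorem sub (h₁ : AgreeBelow N f g) (h₂ : AgreeBelow N f' g') :
    AgreeBelow N (f - f') (g - g') := fun m hm => by simp [h₁ m hm, h₂ m hm]

theorem mul (h₁ : AgreeBelow N f g) (h₂ : AgreeBelow N f' g') :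
    AgreeBelow N (f * f') (g * g') := fun m hm => by
  rw [coeff_mul, coeff_mul]
  refine sum_congr rfl fun p hp => ?_
  have := mem_antidiagonal.mp hp
  rw [h₁ _ (by omega), h₂ _ (by omega)]

theorem sum {ι : Type*} {s : Finset ι} {u v : ι → R⟦X⟧} (h : ∀ i ∈ s, AgreeBelow N (u i) (v i)) :
    AgreeBelow N (∑ i ∈ s, u i) (∑ i ∈ s, v i) := fun m hm => by
  rw [map_sum, map_sum]
  exact sum_congr rfl fun i hi => h i hi m hm

theorem mul_X_pow (f : R⟦X⟧) (hN : N ≤ M) : AgreeBelow N (f * X ^ M) 0 := fun m hm => by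
  rw [coeff_mul_X_pow', if_neg (by omega), map_zero]

theorem X_pow_mul (f : R⟦X⟧) (hN : N ≤ M) : AgreeBelow N (X ^ M * f) 0 := by
  rw [mul_comm]; exact mul_X_pow f hN

theorem X_pow (hN : N ≤ M) : AgreeBelow N (X ^ M : R⟦X⟧) 0 := by
  simpa using mul_X_pow (1 : R⟦X⟧) hN

theorem neg_X_pow (hN : N ≤ M) : AgreeBelow N (-X ^ M : R⟦X⟧) 0 := by
  simpa using mul_X_pow (-1 : R⟦X⟧) hN

theorem mul_zero_right (f : R⟦X⟧) (h : AgreeBelow N g 0) : AgreeBelow N (f * g) 0 := by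
  simpa using (refl f).mul h

theorem mul_zero_left (f : R⟦X⟧) (h : AgreeBelow N g 0) : AgreeBelow N (g * f) 0 := by
  simpa using h.mul (refl f)

theorem eq (h : ∀ N, AgreeBelow N f g) : f = g := by
  ext n; exact h (n + 1) n (Nat.lt_succ_self n)

theorem qInv (hf : constantCoeff f = 1) (hg : constantCoeff g = 1) (h : AgreeBelow N f g) :
    AgreeBelow N (qInv f) (qInv g) := by
  have h₁ : SptBar.qInv f * g * SptBar.qInv g = SptBar.qInv f := by
    rw [mul_assoc, mul_qInv g hg, mul_one]
  have h₂ : SptBar.qInv f * f * SptBar.qInv g = SptBar.qInv g := by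
    rw [mul_comm (SptBar.qInv f), mul_qInv f hf, one_mul]
  have h₃ := ((refl (N := N) (SptBar.qInv f)).mul h.symm).mul (refl (SptBar.qInv g))
  rwa [h₁, h₂] at h₃

end AgreeBelow

theorem agreeBelow_qPochInf (a : R⟦X⟧) {b : ℕ} (hb : 1 ≤ b) {n N : ℕ} (h : n ≤ N) :
    AgreeBelow n (qPochInf a b) (qPoch a b N) := fun _ hm =>
  coeff_qPochInf a hb (hm.trans_le h)

theorem qPochInf_eq (a : R⟦X⟧) {b : ℕ} (hb : 1 ≤ b) :
    qPochInf a b = (1 - a) * qPochInf (a * X ^ b) b := by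
  refine AgreeBelow.eq fun N => ?_
  refine (agreeBelow_qPochInf a hb (Nat.le_succ N)).trans ?_
  rw [qPoch_succ_left]
  exact (AgreeBelow.refl _).mul (agreeBelow_qPochInf _ hb le_rfl).symm

theorem qPochInf_split (a : R⟦X⟧) {b : ℕ} (hb : 1 ≤ b) (n : ℕ) :
    qPochInf a b = qPoch a b n * qPochInf (a * X ^ (b * n)) b := by
  induction n with
  | zero => simp
  | succ n ih =>
    rw [ih, qPoch_succ, qPochInf_eq (a * X ^ (b * n)) hb]
    ring_nf

theorem qPochInf_dissect (a : R⟦X⟧) :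
    qPochInf a 1 = qPochInf a 2 * qPochInf (a * X) 2 := by
  refine AgreeBelow.eq fun N => ?_
  refine (agreeBelow_qPochInf a le_rfl (show N ≤ 2 * N by omega)).trans ?_
  rw [qPoch_even]
  exact (agreeBelow_qPochInf _ one_le_two le_rfl).symm.mul
    (agreeBelow_qPochInf _ one_le_two le_rfl).symm

theorem agreeBelow_qPoch_one {a : R⟦X⟧} {N : ℕ} (ha : AgreeBelow N a 0) (b n : ℕ) :
    AgreeBelow N (qPoch a b n) 1 := by
  induction n with
  | zero => simp [AgreeBelow.refl]
  | succ n ih =>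
    rw [qPoch_succ]
    simpa using ih.mul ((AgreeBelow.refl 1).sub (ha.mul_zero_left _))

theorem agreeBelow_qPochInf_one {a : R⟦X⟧} {N : ℕ} (ha : AgreeBelow N a 0) {b : ℕ} (hb : 1 ≤ b) :
    AgreeBelow N (qPochInf a b) 1 :=
  (agreeBelow_qPochInf a hb le_rfl).trans (agreeBelow_qPoch_one ha b N)

theorem map_qPoch {S : Type*} [CommRing S] (φ : R →+* S) (a : R⟦X⟧) (b n : ℕ) :
    PowerSeries.map φ (qPoch a b n) = qPoch (PowerSeries.map φ a) b n := by
  simp [qPoch, map_prod]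

theorem map_qPochInf {S : Type*} [CommRing S] (φ : R →+* S) (a : R⟦X⟧) (b : ℕ) :
    PowerSeries.map φ (qPochInf a b) = qPochInf (PowerSeries.map φ a) b := by
  ext n
  simp only [qPochInf, coeff_map, coeff_mk, ← map_qPoch]

/-! ### Inverses -/

theorem qInv_unique {f g : R⟦X⟧} (hf : constantCoeff f = 1) (h : f * g = 1) : qInv f = g := by
  calc qInv f = qInv f * (f * g) := by rw [h, mul_one]
    _ = f * qInv f * g := by ring
    _ = g := by rw [mul_qInv f hf, one_mul]

theorem qInv_mul {f g : R⟦X⟧} (hf : constantCoeff f = 1) (hg : constantCoeff g = 1) :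
    qInv (f * g) = qInv f * qInv g := by
  refine qInv_unique (by simp [hf, hg]) ?_
  calc f * g * (qInv f * qInv g) = (f * qInv f) * (g * qInv g) := by ring
    _ = 1 := by rw [mul_qInv f hf, mul_qInv g hg, one_mul]

@[simp] theorem qInv_one : qInv (1 : R⟦X⟧) = 1 := qInv_unique (by simp) (by simp)

theorem map_qInv {S : Type*} [CommRing S] (φ : R →+* S) {f : R⟦X⟧} (hf : constantCoeff f = 1) :
    PowerSeries.map φ (qInv f) = qInv (PowerSeries.map φ f) := by
  refine (qInv_unique ?_ ?_).symm
  · rw [← coeff_zero_eq_constantCoeff_apply, coeff_map, coeff_zero_eq_constantCoeff_apply, hf,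
      map_one]
  · rw [← map_mul, mul_qInv f hf, map_one]

/-- Used to bring fractions over a common denominator, so that identities between them reduce to
polynomial ones. -/
theorem qInv_cancel_right {f g : R⟦X⟧} (hf : constantCoeff f = 1) (hg : constantCoeff g = 1) :
    qInv f = qInv (f * g) * g := by
  rw [qInv_mul hf hg, mul_assoc, mul_comm (qInv g), mul_qInv g hg, mul_one]

/-! ### Formal sums -/

/-- The sum of a sequence of power series whose `i`-th term is divisible by `X ^ i`. -/
def formalSum (f : ℕ → R⟦X⟧) : R⟦X⟧ :=
  PowerSeries.mk fun n => coeff n (∑ i ∈ range (n + 1), f i)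

theorem agreeBelow_formalSum {f : ℕ → R⟦X⟧} (hf : ∀ i, AgreeBelow i (f i) 0) {N M : ℕ}
    (h : N ≤ M) : AgreeBelow N (formalSum f) (∑ i ∈ range M, f i) := fun m hm => by
  rw [formalSum, coeff_mk, map_sum, map_sum]
  refine sum_subset (range_mono (by omega)) fun i _ hi => ?_
  rw [mem_range] at hi
  rw [hf i m (by omega), map_zero]

theorem formalSum_eq {f : ℕ → R⟦X⟧} (hf : ∀ i, AgreeBelow i (f i) 0) {g : R⟦X⟧}
    (h : ∀ N, AgreeBelow N (∑ i ∈ range N, f i) g) : formalSum f = g :=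
  AgreeBelow.eq fun N => (agreeBelow_formalSum hf le_rfl).trans (h N)

theorem mul_formalSum {f : ℕ → R⟦X⟧} (hf : ∀ i, AgreeBelow i (f i) 0) (g : R⟦X⟧) :
    g * formalSum f = formalSum fun i => g * f i := by
  refine (formalSum_eq (fun i => (hf i).mul_zero_right g) fun N => ?_).symm
  rw [← mul_sum]
  exact (AgreeBelow.refl g).mul (agreeBelow_formalSum hf le_rfl).symm

theorem formalSum_succ {f : ℕ → R⟦X⟧} (hf : ∀ i, AgreeBelow i (f i) 0) :
    formalSum f = f 0 + formalSum fun i => f (i + 1) := by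
  refine AgreeBelow.eq fun N => ?_
  refine (agreeBelow_formalSum hf (Nat.le_succ N)).trans ?_
  rw [sum_range_succ', add_comm]
  exact (AgreeBelow.refl _).add
    (agreeBelow_formalSum (fun i => (hf (i + 1)).mono (Nat.le_succ i)) le_rfl).symm

theorem hasSum_formalSum [TopologicalSpace R] {f : ℕ → R⟦X⟧} (hf : ∀ i, AgreeBelow i (f i) 0) :
    HasSum f (formalSum f) := by
  rw [PowerSeries.WithPiTopology.hasSum_iff_hasSum_coeff]
  intro n
  rw [formalSum, coeff_mk, map_sum]
  refine hasSum_sum_of_ne_finset_zero fun i hi => ?_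
  rw [mem_range] at hi
  rw [hf i n (by omega), map_zero]

end Tools

/-! ### A contiguous relation with closed partial sums -/

section Telescoping

variable {R : Type*} [CommRing R] (z w : R)

/-- The `n`-th term of
`∑ (z, w Y, q Y; q²)_n q^{2n} / (q², -q Y, -q² Y; q²)_n` with `Y = q^{2M}`. -/
def kTerm (M n : ℕ) : R⟦X⟧ :=
  qPoch (C z) 2 n * qPoch (C w * X ^ (2 * M)) 2 n * qPoch (X ^ (2 * M + 1)) 2 n * X ^ (2 * n) *
    qInv (qPoch (X ^ 2) 2 n * (qPoch (-X ^ (2 * M + 1)) 2 n * qPoch (-X ^ (2 * M + 2)) 2 n))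

/-- The sum of `kTerm z w M n` over `n`. -/
def kSum (M : ℕ) : R⟦X⟧ := formalSum (kTerm z w M)

/-- `(1 + w q^{2M+1}) (1 + w q^{2M+2}) / ((1 + q^{2M+1}) (1 + q^{2M+2}))`. -/
def kRatio (M : ℕ) : R⟦X⟧ :=
  (1 + C w * X ^ (2 * M + 1)) * (1 + C w * X ^ (2 * M + 2)) *
    qInv ((1 + X ^ (2 * M + 1)) * (1 + X ^ (2 * M + 2)))

theorem agreeBelow_kTerm (M n : ℕ) : AgreeBelow n (kTerm z w M n) 0 := by
  unfold kTerm
  exact (AgreeBelow.mul_X_pow _ (by omega)).mul_zero_left _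

/-- The inverse of `(q²; q²)_n (-q^{2M+1}; q²)_{n+1} (-q^{2M+2}; q²)_{n+1}`. -/
def kInv (R : Type*) [CommRing R] (M n : ℕ) : R⟦X⟧ :=
  qInv (qPoch (X ^ 2) 2 n *
    (qPoch (-X ^ (2 * M + 1)) 2 (n + 1) * qPoch (-X ^ (2 * M + 2)) 2 (n + 1)))

theorem constantCoeff_kDen (M n k : ℕ) : constantCoeff (qPoch (X ^ 2 : R⟦X⟧) 2 n *
    (qPoch (-X ^ (2 * M + 1)) 2 k * qPoch (-X ^ (2 * M + 2)) 2 k)) = 1 := by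
  rw [map_mul, map_mul, constantCoeff_qPoch _ _ _ (by simp),
    constantCoeff_qPoch _ _ _ (by simp), constantCoeff_qPoch _ _ _ (by simp)]
  simp

theorem kInv_succ (M n : ℕ) : kInv R M n = kInv R M (n + 1) * ((1 - X ^ (2 * (n + 1))) *
    ((1 + X ^ (2 * M + 1) * X ^ (2 * (n + 1))) * (1 + X ^ (2 * M + 2) * X ^ (2 * (n + 1))))) := by
  have h := qInv_cancel_right (constantCoeff_kDen (R := R) M n (n + 1))
    (g := (1 - X ^ (2 * (n + 1))) *
    ((1 + X ^ (2 * M + 1) * X ^ (2 * (n + 1))) * (1 + X ^ (2 * M + 2) * X ^ (2 * (n + 1)))))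
    (by simp)
  rw [kInv, h, kInv]
  congr 2
  rw [qPoch_succ (X ^ 2) 2 n, qPoch_succ (-X ^ (2 * M + 1)) 2 (n + 1),
    qPoch_succ (-X ^ (2 * M + 2)) 2 (n + 1)]
  ring

theorem kTerm_eq (M n : ℕ) : kTerm z w M n =
    qPoch (C z) 2 n * qPoch (C w * X ^ (2 * M)) 2 n * qPoch (X ^ (2 * M + 1)) 2 n * X ^ (2 * n) *
      (kInv R M n *
        ((1 + X ^ (2 * M + 1) * X ^ (2 * n)) * (1 + X ^ (2 * M + 2) * X ^ (2 * n)))) := by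
  rw [kTerm, kInv]
  congr 1
  rw [qInv_cancel_right (constantCoeff_kDen (R := R) M n n)
    (g := ((1 + X ^ (2 * M + 1) * X ^ (2 * n)) * (1 + X ^ (2 * M + 2) * X ^ (2 * n))))
    (by simp)]
  congr 2
  rw [qPoch_succ, qPoch_succ]
  ring

/-- The denominator of `kRatio` supplies the first factors of the two products that start at
-q^{2M+1} and -q^{2M+2}, so the terms for M+1 and for M share the denominator `kInv`. -/
theorem kRatio_mul_kTerm (M n : ℕ) : kRatio w M * kTerm z w (M + 1) n =
    qPoch (C z) 2 n * qPoch (C w * X ^ (2 * M + 2)) 2 n * qPoch (X ^ (2 * M + 3)) 2 n *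
      X ^ (2 * n) * kInv R M n * ((1 + C w * X ^ (2 * M + 1)) * (1 + C w * X ^ (2 * M + 2))) := by
  have h : kInv R M n = qInv ((1 + X ^ (2 * M + 1)) * (1 + X ^ (2 * M + 2))) *
      qInv (qPoch (X ^ 2) 2 n *
        (qPoch (-X ^ (2 * (M + 1) + 1)) 2 n * qPoch (-X ^ (2 * (M + 1) + 2)) 2 n)) := by
    rw [← qInv_mul (by simp) (constantCoeff_kDen _ _ _), kInv, qPoch_succ_left _ 2 n,
      qPoch_succ_left _ 2 n]
    congr 1
    ring_nf
  rw [h, kRatio, kTerm]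
  ring_nf

/-- The combination is chosen so that its partial sums have a closed form. Over the common
denominator `kInv`, both the base case and the induction step are polynomial identities modulo zw =
1. -/
theorem sum_kTerm_sub (hz : z * w = 1) (M n : ℕ) :
    ∑ i ∈ range (n + 1), (kTerm z w M i - C z * (kRatio w M * kTerm z w (M + 1) i)) =
      qPoch (C z) 2 (n + 1) * qPoch (C w * X ^ (2 * M + 2)) 2 n * qPoch (X ^ (2 * M + 3)) 2 n *
        kInv R M n * (1 - C w * X ^ (4 * M + 2 * n + 3)) := by
  have hz' : (C z * C w : R⟦X⟧) = 1 := by rw [← map_mul, hz, map_one]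
  induction n with
  | zero =>
    rw [sum_range_one, kRatio_mul_kTerm, kTerm_eq]
    simp only [qPoch_zero, qPoch_succ]
    linear_combination kInv R M 0 *
      (- X ^ (2 * M + 1) - X ^ (2 * M + 2) - X ^ (4 * M + 3) - X ^ (4 * M + 3) * C w) * hz'
  | succ n ih =>
    rw [sum_range_succ, ih, kRatio_mul_kTerm, kTerm_eq, kInv_succ M n,
      qPoch_succ_left (C w * X ^ (2 * M)), qPoch_succ_left (X ^ (2 * M + 1)),
      show C w * X ^ (2 * M) * X ^ 2 = C w * (X ^ (2 * M + 2) : R⟦X⟧) by ring,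
      show X ^ (2 * M + 1) * X ^ 2 = (X ^ (2 * M + 3) : R⟦X⟧) by ring,
      qPoch_succ (C z) 2 (n + 1), qPoch_succ (C w * X ^ (2 * M + 2)) 2 n,
      qPoch_succ (X ^ (2 * M + 3)) 2 n]
    -- The multiplier of `hz'` is the quotient of the difference of the two sides by zw - 1.
    linear_combination (-(qPoch (C z) 2 (n + 1) * qPoch (C w * X ^ (2 * M + 2)) 2 n *
      qPoch (X ^ (2 * M + 3)) 2 n * kInv R M (n + 1) *
      (X ^ (2 * n + 2) * (1 - X ^ (2 * n + 2) * X ^ (2 * M + 1)) *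
        (1 - X ^ (2 * n + 2) * X ^ (2 * M) * C w) * X ^ (2 * M) *
        (X + X ^ 2 + X ^ 3 * X ^ (2 * M) * C w + X ^ 3 * X ^ (2 * M) * X ^ (2 * n + 2))))) * hz'

end Telescoping

/-! ### From the recurrence to a series in `boundedGF` -/

section Transformation

variable {R : Type*} [CommRing R] (z w : R)

/-- The limit n → ∞ of `sum_kTerm_sub`: the finite products become infinite ones and the last factor
1 - w q^{4M+2n+3} tends to 1. -/
theorem kSum_sub (hz : z * w = 1) (M : ℕ) :
    kSum z w M - C z * (kRatio w M * kSum z w (M + 1)) =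
      qPochInf (C z) 2 * qPochInf (C w * X ^ (2 * M + 2)) 2 * qPochInf (X ^ (2 * M + 3)) 2 *
        qInv (qPochInf (X ^ 2) 2 *
          (qPochInf (-X ^ (2 * M + 1)) 2 * qPochInf (-X ^ (2 * M + 2)) 2)) := by
  refine AgreeBelow.eq fun N => ?_
  have h₁ : AgreeBelow N (kSum z w M - C z * (kRatio w M * kSum z w (M + 1)))
      (∑ i ∈ range (N + 1), (kTerm z w M i - C z * (kRatio w M * kTerm z w (M + 1) i))) := by
    rw [sum_sub_distrib, ← mul_sum, ← mul_sum]
    exact (agreeBelow_formalSum (agreeBelow_kTerm z w M) (Nat.le_succ N)).sub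
      ((AgreeBelow.refl _).mul ((AgreeBelow.refl _).mul
        (agreeBelow_formalSum (agreeBelow_kTerm z w (M + 1)) (Nat.le_succ N))))
  refine h₁.trans ?_
  rw [sum_kTerm_sub z w hz]
  have h₂ : AgreeBelow N (1 - C w * X ^ (4 * M + 2 * N + 3)) (1 : R⟦X⟧) := by
    simpa using (AgreeBelow.refl (1 : R⟦X⟧)).sub
      (AgreeBelow.mul_X_pow (C w) (show N ≤ 4 * M + 2 * N + 3 by omega))
  rw [← mul_one (qInv (qPochInf (X ^ 2) 2 * _)), ← mul_assoc]
  refine AgreeBelow.mul (AgreeBelow.mul ?_ ?_) h₂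
  · exact ((agreeBelow_qPochInf _ one_le_two (by omega)).symm.mul
      (agreeBelow_qPochInf _ one_le_two (by omega)).symm).mul
      (agreeBelow_qPochInf _ one_le_two (by omega)).symm
  · refine AgreeBelow.qInv (constantCoeff_kDen _ _ _) ?_ ?_
    · simp [constantCoeff_qPochInf]
    · exact (agreeBelow_qPochInf _ one_le_two (by omega)).symm.mul
        ((agreeBelow_qPochInf _ one_le_two (by omega)).symm.mul
        (agreeBelow_qPochInf _ one_le_two (by omega)).symm)

/-- This is the partial sum of the series to which `kSum` degenerates as M → ∞; it telescopes. -/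
theorem sum_qBinomial (n : ℕ) :
    ∑ i ∈ range (n + 1), qPoch (C z) 2 i * X ^ (2 * i) * qInv (qPoch (X ^ 2) 2 i) =
      qPoch (C z * X ^ 2) 2 n * qInv (qPoch (X ^ 2) 2 n) := by
  induction n with
  | zero => simp
  | succ n ih =>
    rw [sum_range_succ, ih, qInv_cancel_right (constantCoeff_qPoch _ 2 n (by simp))
      (show constantCoeff (1 - X ^ 2 * X ^ (2 * n) : R⟦X⟧) = 1 by simp), ← qPoch_succ,
      qPoch_succ_left (C z), qPoch_succ (C z * X ^ 2)]
    ring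

/-- Up to order q^M, every factor of `kTerm` involving q^{2M} is 1, and what remains is the sum in
`sum_qBinomial`. -/
theorem agreeBelow_kSum (M : ℕ) :
    AgreeBelow M (kSum z w M) (qPochInf (C z * X ^ 2) 2 * qInv (qPochInf (X ^ 2) 2)) := by
  have h₁ : AgreeBelow M (kSum z w M)
      (∑ i ∈ range (M + 1), qPoch (C z) 2 i * X ^ (2 * i) * qInv (qPoch (X ^ 2) 2 i)) := by
    refine (agreeBelow_formalSum (agreeBelow_kTerm z w M) (Nat.le_succ M)).trans ?_
    refine AgreeBelow.sum fun i _ => ?_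
    have hn : AgreeBelow M (qPoch (C z) 2 i * qPoch (C w * X ^ (2 * M)) 2 i *
        qPoch (X ^ (2 * M + 1)) 2 i) (qPoch (C z) 2 i) := by
      simpa using ((AgreeBelow.refl (qPoch (C z) 2 i)).mul (agreeBelow_qPoch_one
        (AgreeBelow.mul_X_pow (C w) (show M ≤ 2 * M by omega)) 2 i)).mul
        (agreeBelow_qPoch_one (AgreeBelow.X_pow (by omega)) 2 i)
    refine (hn.mul (AgreeBelow.refl _)).mul
      (AgreeBelow.qInv (constantCoeff_kDen _ _ _) (constantCoeff_qPoch _ _ _ (by simp)) ?_)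
    simpa using (AgreeBelow.refl (qPoch (X ^ 2 : R⟦X⟧) 2 i)).mul
      ((agreeBelow_qPoch_one (AgreeBelow.neg_X_pow (by omega)) 2 i).mul
        (agreeBelow_qPoch_one (AgreeBelow.neg_X_pow (by omega)) 2 i))
  refine h₁.trans ?_
  rw [sum_qBinomial]
  exact (agreeBelow_qPochInf _ one_le_two le_rfl).symm.mul
    (AgreeBelow.qInv (constantCoeff_qPoch _ _ _ (by simp))
      (constantCoeff_qPochInf _ _ (by simp)) (agreeBelow_qPochInf _ one_le_two le_rfl).symm)

/-- The generating function `(-w q; q)_{2N} / ((w q²; q²)_N (q; q²)_{N+1})` of overpartitions with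
overlined parts at most `2N` and non-overlined parts at most `2N+1`. -/
def boundedGF (N : ℕ) : R⟦X⟧ :=
  qPoch (-(C w * X)) 1 (2 * N) * qInv (qPoch (C w * X ^ 2) 2 N * qPoch X 2 (N + 1))

/-- The factor `(-w q; q)_{2M} (q²; q²)_∞ (-q^{2M+1}; q)_∞ /
((q; q²)_∞ (z q²; q²)_∞ (w q²; q²)_∞)`. -/
def tailFactor (M : ℕ) : R⟦X⟧ :=
  qPoch (-(C w * X)) 1 (2 * M) * (qPochInf (-X ^ (2 * M + 1)) 1 * qPochInf (X ^ 2) 2) *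
    qInv (qPochInf X 2 * qPochInf (C z * X ^ 2) 2 * qPochInf (C w * X ^ 2) 2)

/-- `tailFactor` is an integrating factor: it absorbs `kRatio`, leaving only the constant z in the
recurrence. -/
theorem tailFactor_mul_kRatio (M : ℕ) :
    tailFactor z w M * kRatio w M = tailFactor z w (M + 1) := by
  have h : (1 + X ^ (2 * M + 1) : R⟦X⟧) * (1 + X ^ (2 * M + 2)) *
      qInv ((1 + X ^ (2 * M + 1)) * (1 + X ^ (2 * M + 2))) = 1 := mul_qInv _ (by simp)
  rw [tailFactor, tailFactor, kRatio, show 2 * (M + 1) = 2 * M + 1 + 1 by ring, qPoch_succ,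
    qPoch_succ, qPochInf_split (-X ^ (2 * M + 1)) le_rfl 2, qPoch_succ, qPoch_succ, qPoch_zero,
    show (-X ^ (2 * M + 1) * X ^ (1 * 2) : R⟦X⟧) = -X ^ (2 * M + 1 + 1 + 1) by ring]
  linear_combination (qPoch (-(C w * X)) 1 (2 * M) * (1 + C w * X ^ (2 * M + 1)) *
    (1 + C w * X ^ (2 * M + 2)) * qPochInf (-X ^ (2 * M + 1 + 1 + 1)) 1 * qPochInf (X ^ 2) 2 *
    qInv (qPochInf X 2 * qPochInf (C z * X ^ 2) 2 * qPochInf (C w * X ^ 2) 2)) * h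

theorem qInv_boundedDen (M : ℕ) : qInv (qPoch (C w * X ^ 2) 2 M * qPoch X 2 (M + 1) : R⟦X⟧) =
    qInv (qPochInf X 2 * qPochInf (C z * X ^ 2) 2 * qPochInf (C w * X ^ 2) 2) *
      (qPochInf (C z * X ^ 2) 2 * qPochInf (C w * X ^ (2 * M + 2)) 2 *
        qPochInf (X ^ (2 * M + 3)) 2) := by
  rw [qInv_cancel_right (f := qPoch (C w * X ^ 2) 2 M * qPoch X 2 (M + 1))
    (g := qPochInf (C z * X ^ 2) 2 * qPochInf (C w * X ^ (2 * M + 2)) 2 *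
        qPochInf (X ^ (2 * M + 3)) 2)
    (by simp [constantCoeff_qPoch]) (by simp [constantCoeff_qPochInf])]
  congr 2
  rw [qPochInf_split X one_le_two (M + 1), qPochInf_split (C w * X ^ 2) one_le_two M,
    show (X * X ^ (2 * (M + 1)) : R⟦X⟧) = X ^ (2 * M + 3) by ring,
    show (C w * X ^ 2 * X ^ (2 * M) : R⟦X⟧) = C w * X ^ (2 * M + 2) by ring]
  ring

/-- The inhomogeneous term of `kSum_sub` contains (z; q²)_∞ = (1-z)(z q²; q²)_∞; multiplied by
`tailFactor`, everything except 1-z collapses to `boundedGF`. -/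
theorem tailFactor_mul_kSum (hz : z * w = 1) (M : ℕ) :
    tailFactor z w M * kSum z w M = (1 - C z) * boundedGF w M +
      C z * (tailFactor z w (M + 1) * kSum z w (M + 1)) := by
  rw [← tailFactor_mul_kRatio, boundedGF, qInv_boundedDen z w]
  have h := kSum_sub z w hz M
  have hd : qPochInf (-X ^ (2 * M + 1)) 1 =
      qPochInf (-X ^ (2 * M + 1) : R⟦X⟧) 2 * qPochInf (-X ^ (2 * M + 2)) 2 := by
    rw [qPochInf_dissect, show (-X ^ (2 * M + 1) * X : R⟦X⟧) = -X ^ (2 * M + 2) by ring]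
  have hi := mul_qInv (qPochInf (X ^ 2 : R⟦X⟧) 2 *
    (qPochInf (-X ^ (2 * M + 1)) 2 * qPochInf (-X ^ (2 * M + 2)) 2))
    (by simp [constantCoeff_qPochInf])
  rw [qPochInf_eq (C z) one_le_two] at h
  rw [eq_add_of_sub_eq h, tailFactor, hd]
  linear_combination (qPoch (-(C w * X)) 1 (2 * M) *
    qInv (qPochInf X 2 * qPochInf (C z * X ^ 2) 2 * qPochInf (C w * X ^ 2) 2) *
      ((1 - C z) * qPochInf (C z * X ^ 2) 2 * qPochInf (C w * X ^ (2 * M + 2)) 2 *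
        qPochInf (X ^ (2 * M + 3)) 2)) * hi

theorem tailFactor_zero_mul_kSum (hz : z * w = 1) (M : ℕ) :
    tailFactor z w 0 * kSum z w 0 =
      (1 - C z) * ∑ N ∈ range M, C z ^ N * boundedGF w N +
        C z ^ M * (tailFactor z w M * kSum z w M) := by
  induction M with
  | zero => simp
  | succ M ih =>
    rw [ih, tailFactor_mul_kSum z w hz M, sum_range_succ]
    ring

/-- Identifies the remainder after M iterations with the one that Abel summation leaves in
`agreeBelow_rankGF`. -/
theorem agreeBelow_tailFactor_mul_kSum (M : ℕ) :
    AgreeBelow M (tailFactor z w M * kSum z w M) (boundedGF w M) := by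
  refine ((AgreeBelow.refl _).mul (agreeBelow_kSum z w M)).trans ?_
  rw [boundedGF, qInv_boundedDen z w, tailFactor]
  have hi := mul_qInv (qPochInf (X ^ 2 : R⟦X⟧) 2) (by simp [constantCoeff_qPochInf])
  have h₁ : AgreeBelow M (qPochInf (-X ^ (2 * M + 1) : R⟦X⟧) 1) 1 :=
    agreeBelow_qPochInf_one (AgreeBelow.neg_X_pow (by omega)) le_rfl
  have h₂ : AgreeBelow M (qPochInf (C w * X ^ (2 * M + 2) : R⟦X⟧) 2 *
      qPochInf (X ^ (2 * M + 3)) 2) 1 := by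
    simpa using (agreeBelow_qPochInf_one (AgreeBelow.mul_X_pow (C w)
      (show M ≤ 2 * M + 2 by omega)) one_le_two).mul
      (agreeBelow_qPochInf_one (AgreeBelow.X_pow (by omega)) one_le_two)
  have h₃ := (AgreeBelow.refl (N := M) (qPoch (-(C w * X)) 1 (2 * M) *
    qInv (qPochInf X 2 * qPochInf (C z * X ^ 2) 2 * qPochInf (C w * X ^ 2) 2) *
      qPochInf (C z * X ^ 2) 2)).mul (h₁.trans h₂.symm)
  convert h₃ using 1
  · linear_combination (qPoch (-(C w * X)) 1 (2 * M) * qPochInf (-X ^ (2 * M + 1)) 1 *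
      qInv (qPochInf X 2 * qPochInf (C z * X ^ 2) 2 * qPochInf (C w * X ^ 2) 2) *
      qPochInf (C z * X ^ 2) 2) * hi
  · ring

end Transformation

/-! ### The rank generating function -/

instance (n : ℕ) : Fintype (Overpartition n) := Fintype.ofFinite _

namespace Overpartition

variable {n : ℕ} (π : Overpartition n)

/-- The number of overlined parts and even parts. -/
def numMarked : ℕ := π.overlined.card + π.nonOverlined.countP (fun i => ¬ Odd i)

/-- `⌈l(π)/2⌉ - χ(π)`. -/
def halfLargest : ℕ := (π.largest + 1) / 2 - π.chi

/-- The overpartitions counted by `boundedGF`. -/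
def Bounded (N : ℕ) : Prop :=
  (∀ i ∈ π.overlined, i ≤ 2 * N) ∧ ∀ i ∈ π.toPartition.parts, i ≤ 2 * N + 1

theorem overlined_le_parts : π.overlined.val ≤ π.toPartition.parts :=
  (Multiset.le_iff_subset π.overlined.nodup).mpr fun _ hi =>
    Multiset.mem_toFinset.mp (π.overlined_subset hi)

theorem numMarked_add_numOddNonOverlined :
    π.numMarked + π.numOddNonOverlined = π.numParts := by
  have h₁ := Multiset.card_eq_countP_add_countP (fun i => Odd i) π.nonOverlined
  have h₂ : π.nonOverlined.card + π.overlined.card = π.numParts := by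
    rw [nonOverlined, Multiset.card_sub π.overlined_le_parts, numParts]
    exact Nat.sub_add_cancel (Multiset.card_le_card π.overlined_le_parts)
  simp only [numMarked, numOddNonOverlined]
  omega

theorem chi_le : π.chi ≤ (π.largest + 1) / 2 := by
  unfold chi
  split_ifs with h
  · obtain ⟨k, hk⟩ := h.1
    omega
  · omega

theorem ceil_half (l : ℕ) : ⌈(l : ℚ) / 2⌉ = ((l + 1) / 2 : ℕ) := by
  rw [Int.ceil_eq_iff]
  obtain ⟨k, rfl | rfl⟩ := Nat.even_or_odd' l
  · rw [show (2 * k + 1) / 2 = k by omega]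
    push_cast
    constructor <;> linarith
  · rw [show (2 * k + 1 + 1) / 2 = k + 1 by omega]
    push_cast
    constructor <;> linarith

/-- Parts that are not odd and non-overlined are exactly the marked ones, so the terms -#(π) +
#(π_o) amount to minus their number. -/
theorem m2Rank_eq : π.m2Rank = π.halfLargest - π.numMarked := by
  have h₁ := π.numMarked_add_numOddNonOverlined
  have h₂ := π.chi_le
  rw [m2Rank, ceil_half, halfLargest, Nat.cast_sub h₂]
  omega

theorem le_largest {i : ℕ} (hi : i ∈ π.toPartition.parts) : i ≤ π.largest :=
  Multiset.le_sup hi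

theorem largest_mem (h : π.largest ≠ 0) : π.largest ∈ π.toPartition.parts := by
  by_contra hc
  have : π.largest ≤ π.largest - 1 := Multiset.sup_le.mpr fun i hi => by
    have h₁ := π.le_largest hi
    have h₂ : i ≠ π.largest := fun h => hc (h ▸ hi)
    omega
  omega

theorem largest_le : π.largest ≤ n := by
  refine Multiset.sup_le.mpr fun i hi => ?_
  rw [← π.toPartition.parts_sum]
  exact Multiset.le_sum_of_mem hi

theorem halfLargest_le : π.halfLargest ≤ n := by
  have := π.largest_le
  unfold halfLargest
  omega

/-- The correction `chi` matters only when the largest part is odd and non-overlined: it lets 2N+1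
occur non-overlined at level N, while an overlined 2N+1 already has level N+1. -/
theorem bounded_iff (N : ℕ) : π.Bounded N ↔ π.halfLargest ≤ N := by
  have hp : ∀ i ∈ π.overlined, i ∈ π.toPartition.parts := fun i hi =>
    Multiset.mem_toFinset.mp (π.overlined_subset hi)
  unfold halfLargest chi
  constructor
  · rintro ⟨h₁, h₂⟩
    by_cases h0 : π.largest = 0
    · omega
    · have h₃ := h₂ _ (π.largest_mem h0)
      split_ifs with h
      · omega
      · by_cases h₄ : π.largest = 2 * N + 1
        · have h₅ : π.largest ∈ π.overlined := by
            by_contra h₆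
            exact h ⟨⟨N, h₄⟩, h₆⟩
          have := h₁ _ h₅
          omega
        · omega
  · intro h
    split_ifs at h with hc
    · obtain ⟨⟨k, hk⟩, h₂⟩ := hc
      refine ⟨fun i hi => ?_, fun i hi => ?_⟩
      · have h₃ := π.le_largest (hp i hi)
        have h₄ : i ≠ π.largest := fun h => h₂ (h ▸ hi)
        omega
      · have := π.le_largest hi
        omega
    · have h₁ : π.largest ≤ 2 * N := by omega
      exact ⟨fun i hi => (π.le_largest (hp i hi)).trans h₁,
        fun i hi => (π.le_largest hi).trans (by omega)⟩

end Overpartition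

/-! ### Overpartitions weighted one part size at a time -/

section Weights

variable {R : Type*} [CommRing R] (w : R)

/-- The weight of a non-overlined part `i`. -/
def partWeight (i : ℕ) : R := if Odd i then 1 else w

/-- The weight of `c` copies of the part `i`, the first one overlined. -/
def overlinedWeight (N i c : ℕ) : R := if i ≤ 2 * N then w * partWeight w i ^ (c - 1) else 0

/-- The weight of `c` copies of the part `i`, none of them overlined. -/
def nonOverlinedWeight (N i c : ℕ) : R := if i ≤ 2 * N + 1 then partWeight w i ^ c else 0

theorem prod_map_partWeight (s : Multiset ℕ) :
    (s.map (partWeight w)).prod = w ^ s.countP (fun i => ¬ Odd i) := by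
  induction s using Multiset.induction_on with
  | empty => simp
  | cons a s ih =>
    rw [Multiset.map_cons, Multiset.prod_cons, ih]
    by_cases h : Odd a
    · simp [partWeight, h]
    · rw [partWeight, if_neg h, Multiset.countP_cons_of_pos (p := fun i => ¬ Odd i) _ h, pow_succ']

open Classical in
-- Each overlined part and each even non-overlined part contributes one w, and a part violating the
-- bounds contributes a factor 0.
theorem prod_weights {n : ℕ} (π : Overpartition n) (N : ℕ) :
    (∏ i ∈ π.overlined, overlinedWeight w N i (π.toPartition.parts.count i)) *
      ∏ i ∈ π.toPartition.parts.toFinset \ π.overlined,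
        nonOverlinedWeight w N i (π.toPartition.parts.count i) =
      if π.halfLargest ≤ N then w ^ π.numMarked else 0 := by
  by_cases h : π.Bounded N
  · rw [if_pos ((π.bounded_iff N).mp h)]
    have h₁ : ∀ i, π.nonOverlined.count i =
        π.toPartition.parts.count i - if i ∈ π.overlined then 1 else 0 := fun i => by
      rw [Overpartition.nonOverlined, Multiset.count_sub,
        Multiset.count_eq_of_nodup π.overlined.nodup]
      rfl
    have h₂ : ∏ i ∈ π.overlined, overlinedWeight w N i (π.toPartition.parts.count i) =
        ∏ i ∈ π.overlined, w * partWeight w i ^ π.nonOverlined.count i :=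
      prod_congr rfl fun i hi => by rw [overlinedWeight, if_pos (h.1 i hi), h₁, if_pos hi]
    have h₃ : ∏ i ∈ π.toPartition.parts.toFinset \ π.overlined,
        nonOverlinedWeight w N i (π.toPartition.parts.count i) =
        ∏ i ∈ π.toPartition.parts.toFinset \ π.overlined,
          partWeight w i ^ π.nonOverlined.count i :=
      prod_congr rfl fun i hi => by
        rw [mem_sdiff, Multiset.mem_toFinset] at hi
        rw [nonOverlinedWeight, if_pos (h.2 i hi.1), h₁, if_neg hi.2, Nat.sub_zero]
    have h₄ : π.nonOverlined.toFinset ⊆ π.toPartition.parts.toFinset :=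
      Multiset.toFinset_subset.mpr (Multiset.subset_of_le (Multiset.sub_le_self _ _))
    rw [h₂, h₃, prod_mul_distrib, prod_const, mul_assoc,
      mul_comm (∏ i ∈ π.overlined, partWeight w i ^ π.nonOverlined.count i),
      prod_sdiff π.overlined_subset, Overpartition.numMarked, pow_add, ← prod_map_partWeight,
      Finset.prod_multiset_map_count]
    congr 1
    refine (prod_subset h₄ fun i _ hi => ?_).symm
    rw [Multiset.mem_toFinset] at hi
    rw [Multiset.count_eq_zero_of_notMem hi, pow_zero]
  · rw [if_neg fun hc => h ((π.bounded_iff N).mpr hc)]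
    rw [Overpartition.Bounded, not_and_or] at h
    push Not at h
    by_cases hb : ∃ i ∈ π.overlined, 2 * N < i
    · obtain ⟨i, hi, hlt⟩ := hb
      rw [prod_eq_zero hi (by rw [overlinedWeight, if_neg (by omega)]), zero_mul]
    · obtain h | ⟨i, hi, hlt⟩ := h
      · exact absurd h hb
      · have hi' : i ∈ π.toPartition.parts.toFinset \ π.overlined := by
          rw [mem_sdiff, Multiset.mem_toFinset]
          exact ⟨hi, fun hc => hb ⟨i, hc, by omega⟩⟩
        rw [prod_eq_zero hi' (by rw [nonOverlinedWeight, if_neg (by omega)]), mul_zero]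

theorem sum_overpartition {n : ℕ} (F : n.Partition → Finset ℕ → R) :
    ∑ π : Overpartition n, F π.toPartition π.overlined =
      ∑ p : n.Partition, ∑ S ∈ p.parts.toFinset.powerset, F p S := by
  rw [sum_sigma']
  refine sum_bij' (fun π _ => ⟨π.toPartition, π.overlined⟩)
    (fun x hx => ⟨x.1, x.2, mem_powerset.mp (mem_sigma.mp hx).2⟩) ?_ ?_ ?_ ?_ ?_
  · intro π _
    simpa using π.overlined_subset
  all_goals simp

/-- Expanding the product of sums over the part sizes of a partition is the same as choosing which
sizes are overlined. -/
theorem coeff_genFun_weights (N n : ℕ) :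
    coeff n (Nat.Partition.genFun
      fun i c => overlinedWeight w N i c + nonOverlinedWeight w N i c) =
      ∑ π : Overpartition n, if π.halfLargest ≤ N then w ^ π.numMarked else 0 := by
  classical
  simp_rw [← prod_weights]
  rw [sum_overpartition fun p S => (∏ i ∈ S, overlinedWeight w N i (p.parts.count i)) *
      ∏ i ∈ p.parts.toFinset \ S, nonOverlinedWeight w N i (p.parts.count i),
    Nat.Partition.coeff_genFun]
  refine sum_congr rfl fun p _ => ?_
  rw [Finsupp.prod, Multiset.toFinsupp_support]
  simp_rw [Multiset.toFinsupp_apply]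
  rw [prod_add]

end Weights

/-! ### Product form of the bounded series, and the rank series -/

section RankGF

variable {R : Type*} [CommRing R] (z w : R)

theorem prod_partWeight (N : ℕ) :
    ∏ i ∈ range (2 * N + 1), (1 - C (partWeight w (i + 1)) * X ^ (i + 1) : R⟦X⟧) =
      qPoch (C w * X ^ 2) 2 N * qPoch X 2 (N + 1) := by
  induction N with
  | zero => simp [partWeight, qPoch]
  | succ N ih =>
    have h₁ : partWeight w (2 * N + 1 + 1) = w :=
      if_neg (by rw [Nat.not_odd_iff_even]; exact ⟨N + 1, by ring⟩)
    have h₂ : partWeight w (2 * N + 1 + 1 + 1) = 1 := if_pos ⟨N + 1, by ring⟩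
    rw [show 2 * (N + 1) + 1 = 2 * N + 1 + 1 + 1 by ring, prod_range_succ, prod_range_succ, ih,
      h₁, h₂, map_one, qPoch_succ (C w * X ^ 2) 2 N, qPoch_succ X 2 (N + 1)]
    ring

theorem prod_overlinedWeight (N : ℕ) :
    ∏ i ∈ range (2 * N + 1), (1 + C (if i + 1 ≤ 2 * N then w else 0) * X ^ (i + 1) : R⟦X⟧) =
      qPoch (-(C w * X)) 1 (2 * N) := by
  rw [prod_range_succ, if_neg (by omega), map_zero, zero_mul, add_zero, mul_one, qPoch]
  refine prod_congr rfl fun i hi => ?_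
  rw [if_pos (by rw [mem_range] at hi; omega)]
  ring

/-- With p the weight of a non-overlined i, and a = w if i ≤ 2N and a = 0 otherwise, the Euler
factor at i ≤ 2N+1 is a geometric series: 1 + ∑_{c ≥ 1} (a + p) p^{c-1} q^{ic} = (1 + a q^i) / (1 -
p q^i). -/
theorem genFun_weights (N : ℕ) :
    Nat.Partition.genFun (fun i c => overlinedWeight w N i c + nonOverlinedWeight w N i c) =
      boundedGF w N := by
  -- The claim is algebraic; the discrete topology only gives meaning to the infinite sums and
  -- products.
  let _ : TopologicalSpace R := ⊥
  have _ : DiscreteTopology R := ⟨rfl⟩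
  have hfac : ∀ i, i < 2 * N + 1 →
      (1 + ∑' j, (overlinedWeight w N (i + 1) (j + 1) + nonOverlinedWeight w N (i + 1) (j + 1)) •
        (X : R⟦X⟧) ^ ((i + 1) * (j + 1))) * (1 - C (partWeight w (i + 1)) * X ^ (i + 1)) =
      1 + C (if i + 1 ≤ 2 * N then w else 0) * X ^ (i + 1) := by
    intro i hi
    have h0 : constantCoeff (C (partWeight w (i + 1)) * X ^ (i + 1) : R⟦X⟧) = 0 := by simp
    have h₁ := WithPiTopology.tsum_pow_mul_one_sub_of_constantCoeff_eq_zero h0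
    have h₂ : ∀ j, (overlinedWeight w N (i + 1) (j + 1) + nonOverlinedWeight w N (i + 1) (j + 1)) •
        (X : R⟦X⟧) ^ ((i + 1) * (j + 1)) =
        C ((if i + 1 ≤ 2 * N then w else 0) + partWeight w (i + 1)) * X ^ (i + 1) *
          (C (partWeight w (i + 1)) * X ^ (i + 1)) ^ j := by
      intro j
      have h₃ : overlinedWeight w N (i + 1) (j + 1) + nonOverlinedWeight w N (i + 1) (j + 1) =
          ((if i + 1 ≤ 2 * N then w else 0) + partWeight w (i + 1)) *
            partWeight w (i + 1) ^ j := by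
        rw [overlinedWeight, nonOverlinedWeight, if_pos (by omega : i + 1 ≤ 2 * N + 1),
          Nat.add_sub_cancel]
        split_ifs <;> ring
      rw [h₃, smul_eq_C_mul, map_mul, map_pow]
      ring
    rw [tsum_congr h₂, (WithPiTopology.summable_pow_of_constantCoeff_eq_zero h0).tsum_mul_left,
      add_mul, mul_assoc, h₁, map_add]
    ring
  have hone : ∀ i ∉ range (2 * N + 1),
      1 + ∑' j, (overlinedWeight w N (i + 1) (j + 1) + nonOverlinedWeight w N (i + 1) (j + 1)) •
        (X : R⟦X⟧) ^ ((i + 1) * (j + 1)) = 1 := by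
    intro i hi
    rw [mem_range] at hi
    simp [overlinedWeight, nonOverlinedWeight, show ¬ i + 1 ≤ 2 * N by omega,
      show ¬ i ≤ 2 * N by omega]
  have hprod := (Nat.Partition.hasProd_genFun
    fun i c => overlinedWeight w N i c + nonOverlinedWeight w N i c).unique
    (hasProd_prod_of_ne_finset_one hone)
  have hden : constantCoeff (qPoch (C w * X ^ 2) 2 N * qPoch X 2 (N + 1) : R⟦X⟧) = 1 := by
    simp [constantCoeff_qPoch]
  have h : Nat.Partition.genFun
      (fun i c => overlinedWeight w N i c + nonOverlinedWeight w N i c) *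
      (qPoch (C w * X ^ 2) 2 N * qPoch X 2 (N + 1)) = qPoch (-(C w * X)) 1 (2 * N) := by
    rw [hprod, ← prod_partWeight, ← prod_mul_distrib, ← prod_overlinedWeight]
    exact prod_congr rfl fun i hi => hfac i (mem_range.mp hi)
  rw [boundedGF, ← h, mul_assoc, mul_qInv _ hden, mul_one]

theorem coeff_boundedGF (N n : ℕ) : coeff n (boundedGF w N) =
    ∑ π : Overpartition n, if π.halfLargest ≤ N then w ^ π.numMarked else 0 := by
  rw [← genFun_weights, coeff_genFun_weights]

/-- The two-variable generating function of the `M₂`-rank. -/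
def rankGF : R⟦X⟧ :=
  PowerSeries.mk fun n => ∑ π : Overpartition n, z ^ π.halfLargest * w ^ π.numMarked

/-- Abel summation: for o ≤ M the sum is geometric, with (1-z)(z^o + ⋯ + z^{M-1}) = z^o - z^M. -/
theorem one_sub_mul_sum_pow (o M : ℕ) :
    (1 - z) * ∑ N ∈ range M, z ^ N * (if o ≤ N then 1 else 0) +
      z ^ M * (if o ≤ M then 1 else 0) = if o ≤ M then z ^ o else 0 := by
  induction M with
  | zero =>
    rcases Nat.eq_zero_or_pos o with rfl | h
    · simp
    · simp [show ¬ o ≤ 0 by omega]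
  | succ M ih =>
    rw [sum_range_succ]
    rcases lt_trichotomy o (M + 1) with h | h | h
    · rw [if_pos (by omega : o ≤ M)] at *
      rw [if_pos (by omega : o ≤ M + 1), if_pos (by omega : o ≤ M + 1)]
      rw [if_pos (by omega : o ≤ M)] at ih
      linear_combination ih
    · rw [if_neg (by omega : ¬ o ≤ M)] at *
      rw [if_pos (by omega : o ≤ M + 1), if_pos (by omega : o ≤ M + 1), h]
      rw [if_neg (by omega : ¬ o ≤ M)] at ih
      rw [h] at ih
      linear_combination ih
    · rw [if_neg (by omega : ¬ o ≤ M)] at *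
      rw [if_neg (by omega : ¬ o ≤ M + 1), if_neg (by omega : ¬ o ≤ M + 1)]
      rw [if_neg (by omega : ¬ o ≤ M)] at ih
      linear_combination ih

theorem agreeBelow_rankGF (M : ℕ) : AgreeBelow M (rankGF z w)
    ((1 - C z) * ∑ N ∈ range M, C z ^ N * boundedGF w N + C z ^ M * boundedGF w M) := by
  intro n hn
  have h : (1 - C z) * ∑ N ∈ range M, C z ^ N * boundedGF w N + C z ^ M * boundedGF w M =
      C (1 - z) * ∑ N ∈ range M, C (z ^ N) * boundedGF w N + C (z ^ M) * boundedGF w M := by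
    simp
  rw [h, rankGF, coeff_mk, map_add, coeff_C_mul, coeff_C_mul, map_sum]
  simp_rw [coeff_C_mul, coeff_boundedGF, mul_sum]
  rw [sum_comm, ← sum_add_distrib]
  refine sum_congr rfl fun π _ => ?_
  have h₁ := one_sub_mul_sum_pow z π.halfLargest M
  have h₂ : π.halfLargest ≤ M := π.halfLargest_le.trans hn.le
  -- Since `halfLargest` ≤ n < M, the cutoff at M excludes no overpartition of n.
  rw [if_pos h₂, if_pos h₂] at h₁
  rw [if_pos h₂, ← h₁, add_mul, mul_one, mul_sum, sum_mul]
  congr 1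
  refine sum_congr rfl fun N _ => ?_
  split_ifs <;> ring

theorem rankGF_eq (hz : z * w = 1) : rankGF z w = tailFactor z w 0 * kSum z w 0 := by
  refine AgreeBelow.eq fun M => (agreeBelow_rankGF z w M).trans ?_
  rw [tailFactor_zero_mul_kSum z w hz M]
  exact (AgreeBelow.refl _).add
    ((AgreeBelow.refl _).mul (agreeBelow_tailFactor_mul_kSum z w M).symm)

end RankGF

/-! ### Symmetrized moments as a functional on Laurent polynomials -/

/-- The functional sending `z ^ m` to `binom (m + k - 1, 2k)`. -/
def symmCoeff (k : ℕ) : ℤ[T;T⁻¹] →+ ℤ :=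
  (Finsupp.linearCombination ℤ
    fun m : ℤ => Ring.choose (m + k - 1) (2 * k)).toAddMonoidHom.comp
    AddMonoidAlgebra.coeffAddEquiv.toAddMonoidHom

theorem symmCoeff_apply (k : ℕ) (f : ℤ[T;T⁻¹]) : symmCoeff k f =
    f.coeff.sum fun m a => a * Ring.choose (m + k - 1) (2 * k) := rfl

theorem symmCoeff_T (k : ℕ) (m : ℤ) :
    symmCoeff k (LaurentPolynomial.T m) = Ring.choose (m + k - 1) (2 * k) := by
  rw [symmCoeff_apply, LaurentPolynomial.T, AddMonoidAlgebra.coeff_single,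
    Finsupp.sum_single_index (by simp), one_mul]

theorem symmCoeff_eq_finsum (k : ℕ) (f : ℤ[T;T⁻¹]) :
    symmCoeff k f = ∑ᶠ m : ℤ, Ring.choose (m + k - 1) (2 * k) * f.coeff m := by
  rw [symmCoeff_apply, finsum_eq_sum_of_support_subset (s := f.coeff.support), Finsupp.sum]
  · exact sum_congr rfl fun m _ => mul_comm _ _
  · intro m hm
    rw [Function.mem_support] at hm
    rw [Finset.mem_coe, Finsupp.mem_support_iff]
    exact right_ne_zero_of_mul hm

/-- The Laurent polynomial `z - 2 + z⁻¹`. -/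
def symmVar : ℤ[T;T⁻¹] := LaurentPolynomial.T 1 - 2 + LaurentPolynomial.T (-1)

theorem symmVar_mul_T (m : ℤ) : symmVar * LaurentPolynomial.T m =
    LaurentPolynomial.T (m + 1) - (LaurentPolynomial.T m + LaurentPolynomial.T m) +
      LaurentPolynomial.T (m - 1) := by
  rw [symmVar, LaurentPolynomial.T_add, LaurentPolynomial.T_sub]
  ring

theorem laurent_addHom_ext {G : Type*} [AddCommGroup G] {φ ψ : ℤ[T;T⁻¹] →+ G}
    (h : ∀ m, φ (LaurentPolynomial.T m) = ψ (LaurentPolynomial.T m)) : φ = ψ := by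
  ext m
  exact h m

/-- Multiplication by z - 2 + z⁻¹ takes a second central difference of the binomial coefficients;
Pascal's rule applied twice evaluates it. -/
theorem symmCoeff_succ_symmVar_mul (k : ℕ) (f : ℤ[T;T⁻¹]) :
    symmCoeff (k + 1) (symmVar * f) = symmCoeff k f := by
  have h : (symmCoeff (k + 1)).comp (AddMonoidHom.mulLeft symmVar) = symmCoeff k := by
    refine laurent_addHom_ext fun m => ?_
    rw [AddMonoidHom.comp_apply, AddMonoidHom.coe_mulLeft, symmVar_mul_T, map_add, map_sub,
      map_add, symmCoeff_T, symmCoeff_T, symmCoeff_T, symmCoeff_T,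
      show 2 * (k + 1) = 2 * k + 1 + 1 by ring,
      show m + 1 + ((k + 1 : ℕ) : ℤ) - 1 = m + k - 1 + 1 + 1 by push_cast; ring,
      show m + ((k + 1 : ℕ) : ℤ) - 1 = m + k - 1 + 1 by push_cast; ring,
      show m - 1 + ((k + 1 : ℕ) : ℤ) - 1 = m + k - 1 by push_cast; ring]
    simp only [Ring.choose_succ_succ]
    ring
  exact DFunLike.congr_fun h f

/-- For k = 0 the functional is evaluation at z = 1, where z - 2 + z⁻¹ vanishes. -/
theorem symmCoeff_zero_symmVar_mul (f : ℤ[T;T⁻¹]) : symmCoeff 0 (symmVar * f) = 0 := by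
  have h : (symmCoeff 0).comp (AddMonoidHom.mulLeft symmVar) = 0 := by
    refine laurent_addHom_ext fun m => ?_
    rw [AddMonoidHom.comp_apply, AddMonoidHom.coe_mulLeft, symmVar_mul_T, map_add, map_sub,
      map_add]
    simp [symmCoeff_T]
  exact DFunLike.congr_fun h f

theorem symmCoeff_one (k : ℕ) : symmCoeff k 1 = if k = 0 then 1 else 0 := by
  rw [← LaurentPolynomial.T_zero, symmCoeff_T]
  rcases k with _ | k
  · simp
  · rw [show (0 : ℤ) + ((k + 1 : ℕ) : ℤ) - 1 = (k : ℤ) by push_cast; ring, Ring.choose_natCast,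
      Nat.choose_eq_zero_of_lt (by omega), if_neg (by omega), Nat.cast_zero]

/-- Coefficientwise application of `symmCoeff`. -/
def symmMap (k : ℕ) : ℤ[T;T⁻¹]⟦X⟧ →+ ℤ⟦X⟧ where
  toFun f := PowerSeries.mk fun n => symmCoeff k (coeff n f)
  map_zero' := by ext; simp
  map_add' f g := by ext; simp

@[simp] theorem coeff_symmMap (k n : ℕ) (f : ℤ[T;T⁻¹]⟦X⟧) :
    coeff n (symmMap k f) = symmCoeff k (coeff n f) := by
  change coeff n (PowerSeries.mk fun n => symmCoeff k (coeff n f)) = _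
  rw [coeff_mk]

/-- The inclusion of integral power series. -/
def embed : ℤ⟦X⟧ →+* ℤ[T;T⁻¹]⟦X⟧ := PowerSeries.map (Int.castRingHom _)

theorem symmMap_embed_mul (k : ℕ) (g : ℤ⟦X⟧) (f : ℤ[T;T⁻¹]⟦X⟧) :
    symmMap k (embed g * f) = g * symmMap k f := by
  ext n
  rw [coeff_symmMap, coeff_mul, coeff_mul, map_sum]
  refine sum_congr rfl fun p _ => ?_
  rw [embed, coeff_map, eq_intCast, ← zsmul_eq_mul, map_zsmul, coeff_symmMap, smul_eq_mul]

theorem symmMap_succ_symmVar_mul (k : ℕ) (f : ℤ[T;T⁻¹]⟦X⟧) :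
    symmMap (k + 1) (C symmVar * f) = symmMap k f := by
  ext n
  rw [coeff_symmMap, coeff_C_mul, symmCoeff_succ_symmVar_mul, coeff_symmMap]

theorem symmMap_zero_symmVar_mul (f : ℤ[T;T⁻¹]⟦X⟧) : symmMap 0 (C symmVar * f) = 0 := by
  ext n
  rw [coeff_symmMap, coeff_C_mul, symmCoeff_zero_symmVar_mul, map_zero]

theorem symmMap_one (k : ℕ) : symmMap k 1 = if k = 0 then 1 else 0 := by
  ext n
  rw [coeff_symmMap, coeff_one]
  split_ifs with h₁ h₂ h₂ <;> simp [symmCoeff_one, coeff_one, h₁, h₂]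

theorem AgreeBelow.symmMap {N : ℕ} {f g : ℤ[T;T⁻¹]⟦X⟧} (h : AgreeBelow N f g) (k : ℕ) :
    AgreeBelow N (SptBar.symmMap k f) (SptBar.symmMap k g) := fun m hm => by
  rw [coeff_symmMap, coeff_symmMap, h m hm]

theorem symmMap_formalSum (k : ℕ) (f : ℕ → ℤ[T;T⁻¹]⟦X⟧) :
    symmMap k (formalSum f) = formalSum fun i => symmMap k (f i) := by
  ext n
  simp [formalSum]

theorem floor_two_mul_sub_one_half (k : ℕ) :
    ⌊(((2 * k : ℕ) : ℚ) - 1) / 2⌋ = (k : ℤ) - 1 := by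
  rw [Int.floor_eq_iff]
  push_cast
  constructor <;> linarith

theorem mu2bar_eq (k n : ℕ) : mu2bar (2 * k) n = coeff n (symmMap k crankGF) := by
  rw [coeff_symmMap, symmCoeff_eq_finsum, mu2bar, floor_two_mul_sub_one_half]
  simp only [M2bar, add_sub_assoc]

theorem coeff_rankGF (m : ℤ) (n : ℕ) :
    (coeff n (rankGF (LaurentPolynomial.T 1 : ℤ[T;T⁻¹]) (LaurentPolynomial.T (-1)))).coeff m =
      N2bar m n := by
  have h : ∀ π : Overpartition n, (LaurentPolynomial.T 1 : ℤ[T;T⁻¹]) ^ π.halfLargest *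
      LaurentPolynomial.T (-1) ^ π.numMarked = LaurentPolynomial.T π.m2Rank := fun π => by
    rw [LaurentPolynomial.T_pow, LaurentPolynomial.T_pow, ← LaurentPolynomial.T_add, π.m2Rank_eq]
    congr 1
    ring
  rw [rankGF, coeff_mk, N2bar, AddMonoidAlgebra.coeff_sum, Finsupp.finsetSum_apply]
  simp_rw [h, LaurentPolynomial.T_apply]
  rw [sum_boole, Nat.card_eq_fintype_card, Fintype.card_subtype]

theorem eta2bar_eq (k n : ℕ) : eta2bar (2 * k) n =
    coeff n (symmMap k (rankGF (LaurentPolynomial.T 1) (LaurentPolynomial.T (-1)))) := by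
  rw [coeff_symmMap, symmCoeff_eq_finsum, eta2bar, floor_two_mul_sub_one_half]
  simp only [coeff_rankGF, add_sub_assoc]

/-! ### Crank tails and the factorization of the terms of rank minus crank -/

section Telescope

variable {R : Type*} [CommRing R] (z w : R)

theorem mul_qInv_eq_mul_qInv {a b f g : R⟦X⟧} (hf : constantCoeff f = 1)
    (hg : constantCoeff g = 1) (h : a * g = b * f) : a * qInv f = b * qInv g := by
  linear_combination qInv f * qInv g * h - a * qInv f * mul_qInv g hg + b * qInv g * mul_qInv f hf

theorem mul_qInv_mul_mul_qInv {a b f g : R⟦X⟧} (hf : constantCoeff f = 1)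
    (hg : constantCoeff g = 1) : a * qInv f * (b * qInv g) = a * b * qInv (f * g) := by
  rw [qInv_mul hf hg]
  ring

/-- The factor `q^{2n} / (1 - q^{2n})²`. -/
def crankFactor (R : Type*) [CommRing R] (n : ℕ) : R⟦X⟧ :=
  X ^ (2 * n) * qInv ((1 - X ^ (2 * n)) ^ 2)

/-- The factor `(-q^{2n+1}; q)_∞ / (q^{2n+1}; q)_∞`. -/
def overlineFactor (R : Type*) [CommRing R] (n : ℕ) : R⟦X⟧ :=
  qPochInf (-X ^ (2 * n + 1)) 1 * qInv (qPochInf (X ^ (2 * n + 1)) 1)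

/-- The product `∏_{m ≥ n} (1 - q^{2m})² / ((1 - z q^{2m}) (1 - w q^{2m}))`. -/
def crankTail (n : ℕ) : R⟦X⟧ :=
  qPochInf (X ^ (2 * n)) 2 ^ 2 *
    qInv (qPochInf (C z * X ^ (2 * n)) 2 * qPochInf (C w * X ^ (2 * n)) 2)

/-- With x = q^{2n} and zw = 1, (1-x)² - (1-zx)(1-wx) = (z-2+w) x. -/
theorem crankTail_sub_succ (hz : z * w = 1) {n : ℕ} (hn : 1 ≤ n) :
    crankTail z w n - crankTail z w (n + 1) =
      C (z - 2 + w) * (crankFactor R n * crankTail z w n) := by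
  have hz' : (C z * C w : R⟦X⟧) = 1 := by rw [← map_mul, hz, map_one]
  have h0 : 2 * n ≠ 0 := by omega
  have h₁ : crankTail z w n = (1 - X ^ (2 * n)) ^ 2 * crankTail z w (n + 1) *
      qInv ((1 - C z * X ^ (2 * n)) * (1 - C w * X ^ (2 * n))) := by
    rw [crankTail, crankTail, ← mul_assoc, mul_assoc, ← qInv_mul (by simp [constantCoeff_qPochInf])
      (by simp [h0]), qPochInf_eq (X ^ (2 * n)) one_le_two,
      qPochInf_eq (C z * X ^ (2 * n)) one_le_two, qPochInf_eq (C w * X ^ (2 * n)) one_le_two,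
      mul_assoc (C z), mul_assoc (C w), ← pow_add, show 2 * n + 2 = 2 * (n + 1) by ring]
    ring_nf
  have h₂ := mul_qInv ((1 - C z * X ^ (2 * n)) * (1 - C w * X ^ (2 * n)) : R⟦X⟧) (by simp [h0])
  have h₃ := mul_qInv ((1 - X ^ (2 * n)) ^ 2 : R⟦X⟧) (by simp [h0])
  rw [h₁, crankFactor, map_add, map_sub, map_ofNat]
  set i := qInv ((1 - C z * X ^ (2 * n)) * (1 - C w * X ^ (2 * n)) : R⟦X⟧)
  set t := qInv ((1 - X ^ (2 * n)) ^ 2 : R⟦X⟧)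
  set D := crankTail z w (n + 1)
  linear_combination (-(C z - 2 + C w) * X ^ (2 * n) * D * i) * h₃ + D * h₂ -
    D * i * (X ^ (2 * n)) ^ 2 * hz'

theorem agreeBelow_crankTail (n : ℕ) : AgreeBelow n (crankTail z w n) 1 := by
  rcases Nat.eq_zero_or_pos n with rfl | hn
  · intro m hm
    omega
  have h0 : 2 * n ≠ 0 := by omega
  have h₁ : AgreeBelow n (qPochInf (X ^ (2 * n) : R⟦X⟧) 2) 1 :=
    agreeBelow_qPochInf_one (AgreeBelow.X_pow (by omega)) one_le_two
  have h₂ : ∀ a : R, AgreeBelow n (qPochInf (C a * X ^ (2 * n) : R⟦X⟧) 2) 1 := fun a =>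
    agreeBelow_qPochInf_one (AgreeBelow.mul_X_pow _ (by omega)) one_le_two
  have h₃ := (h₁.mul h₁).mul (AgreeBelow.qInv (by simp [constantCoeff_qPochInf, h0]) (by simp)
    ((h₂ z).mul (h₂ w)))
  simpa [crankTail, sq] using h₃

/-- The leading factors of (z; q²)_{n+1} and (w; q²)_{n+1} give (1-z)(1-w) = -(z-2+w). The other
finite products cancel the initial segments of the infinite ones, so that only tails remain. -/
theorem tailFactor_zero_mul_kTerm (hz : z * w = 1) (n : ℕ) :
    tailFactor z w 0 * kTerm z w 0 (n + 1) =
      -(C (z - 2 + w) * (overlineFactor R (n + 1) * crankFactor R (n + 1) *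
        crankTail z w (n + 1))) := by
  have hz' : (C z * C w : R⟦X⟧) = 1 := by rw [← map_mul, hz, map_one]
  have e₁ : qPochInf (-X ^ (2 * 0 + 1) : R⟦X⟧) 1 =
      qPoch (-X ^ (2 * 0 + 1)) 2 (n + 1) * qPoch (-X ^ (2 * 0 + 2)) 2 (n + 1) *
        qPochInf (-X ^ (2 * (n + 1) + 1)) 1 := by
    rw [qPochInf_split _ le_rfl (2 * (n + 1)), qPoch_even,
      show (-X ^ (2 * 0 + 1) * X : R⟦X⟧) = -X ^ (2 * 0 + 2) by ring,
      show (-X ^ (2 * 0 + 1) * X ^ (1 * (2 * (n + 1))) : R⟦X⟧) = -X ^ (2 * (n + 1) + 1) by ring]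
  have e₂ : ∀ a : R, qPochInf (C a * X ^ 2 : R⟦X⟧) 2 =
      qPoch (C a * X ^ 2) 2 n * qPochInf (C a * X ^ (2 * (n + 1))) 2 := fun a => by
    rw [qPochInf_split _ one_le_two n,
      show (C a * X ^ 2 * X ^ (2 * n) : R⟦X⟧) = C a * X ^ (2 * (n + 1)) by ring]
  have e₃ : qPochInf (X : R⟦X⟧) 2 =
      qPoch (X ^ (2 * 0 + 1)) 2 (n + 1) * qPochInf (X ^ (2 * (n + 1) + 1)) 2 := by
    rw [qPochInf_split _ one_le_two (n + 1),
      show (X * X ^ (2 * (n + 1)) : R⟦X⟧) = X ^ (2 * (n + 1) + 1) by ring]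
    simp
  have e₄ : qPochInf (X ^ 2 : R⟦X⟧) 2 =
      qPoch (X ^ 2) 2 (n + 1) * qPochInf (X ^ (2 * (n + 1) + 2)) 2 := by
    rw [qPochInf_split _ one_le_two (n + 1),
      show (X ^ 2 * X ^ (2 * (n + 1)) : R⟦X⟧) = X ^ (2 * (n + 1) + 2) by ring]
  have e₅ : qPochInf (X ^ (2 * (n + 1)) : R⟦X⟧) 2 =
      (1 - X ^ (2 * (n + 1))) * qPochInf (X ^ (2 * (n + 1) + 2)) 2 := by
    rw [qPochInf_eq _ one_le_two, ← pow_add]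
  have e₆ : qPochInf (X ^ (2 * (n + 1) + 1) : R⟦X⟧) 1 =
      qPochInf (X ^ (2 * (n + 1) + 1)) 2 * qPochInf (X ^ (2 * (n + 1) + 2)) 2 := by
    rw [qPochInf_dissect, ← pow_succ]
  have e₇ : ∀ a : R, qPoch (C a * X ^ (2 * 0) : R⟦X⟧) 2 (n + 1) =
      (1 - C a) * qPoch (C a * X ^ 2) 2 n := fun a => by
    rw [qPoch_succ_left, mul_zero, pow_zero, mul_one]
  have e₈ : qPoch (C z : R⟦X⟧) 2 (n + 1) = (1 - C z) * qPoch (C z * X ^ 2) 2 n :=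
    qPoch_succ_left _ _ _
  have e₉ : qPoch (-(C w * X) : R⟦X⟧) 1 (2 * 0) = 1 := by simp
  have hx : (1 - C z) * (1 - C w) = -(C (z - 2 + w) : R⟦X⟧) := by
    rw [map_add, map_sub, map_ofNat]
    linear_combination hz'
  have c₁ : constantCoeff (qPochInf X 2 * qPochInf (C z * X ^ 2) 2 *
      qPochInf (C w * X ^ 2) 2 : R⟦X⟧) = 1 := by simp [constantCoeff_qPochInf]
  have c₂ := constantCoeff_kDen (R := R) 0 (n + 1) (n + 1)
  have c₃ : constantCoeff (qPochInf (X ^ (2 * (n + 1) + 1) : R⟦X⟧) 1) = 1 := by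
    simp [constantCoeff_qPochInf]
  have c₄ : constantCoeff ((1 - X ^ (2 * (n + 1))) ^ 2 : R⟦X⟧) = 1 := by simp
  have c₅ : constantCoeff (qPochInf (C z * X ^ (2 * (n + 1))) 2 *
      qPochInf (C w * X ^ (2 * (n + 1))) 2 : R⟦X⟧) = 1 := by simp [constantCoeff_qPochInf]
  have c₆ : constantCoeff (qPochInf (X ^ (2 * (n + 1) + 1)) 1 *
      (1 - X ^ (2 * (n + 1))) ^ 2 : R⟦X⟧) = 1 := by rw [map_mul, c₃, c₄, one_mul]
  rw [tailFactor, kTerm, mul_qInv_mul_mul_qInv c₁ c₂, overlineFactor, crankFactor, crankTail,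
    mul_qInv_mul_mul_qInv c₃ c₄, mul_qInv_mul_mul_qInv c₆ c₅,
    ← mul_assoc (C (z - 2 + w)), ← neg_mul (C (z - 2 + w) * _)]
  refine mul_qInv_eq_mul_qInv ?_ ?_ ?_
  · rw [map_mul, c₁, c₂, one_mul]
  · rw [map_mul, c₆, c₅, one_mul]
  rw [e₉, e₁, e₂, e₂, e₃, e₄, e₅, e₆, e₇, e₈]
  linear_combination (qPoch (-X ^ (2 * 0 + 1)) 2 (n + 1) * qPoch (-X ^ (2 * 0 + 2)) 2 (n + 1) *
    qPochInf (-X ^ (2 * (n + 1) + 1)) 1 * qPoch (X ^ 2) 2 (n + 1) *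
    qPochInf (X ^ (2 * (n + 1) + 2)) 2 ^ 2 * qPoch (C z * X ^ 2) 2 n *
    qPoch (C w * X ^ 2) 2 n * qPoch (X ^ (2 * 0 + 1)) 2 (n + 1) * X ^ (2 * (n + 1)) *
    qPochInf (X ^ (2 * (n + 1) + 1)) 2 * (1 - X ^ (2 * (n + 1))) ^ 2 *
    qPochInf (C z * X ^ (2 * (n + 1))) 2 * qPochInf (C w * X ^ (2 * (n + 1))) 2) * hx

end Telescope

/-! ### The symmetrized difference as a single sum -/

theorem T_one_mul_T_neg_one :
    (LaurentPolynomial.T 1 * LaurentPolynomial.T (-1) : ℤ[T;T⁻¹]) = 1 := by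
  rw [← LaurentPolynomial.T_add]
  simp

theorem crankGF_eq :
    crankGF = tailFactor (LaurentPolynomial.T 1) (LaurentPolynomial.T (-1)) 0 := by
  simp [crankGF, tailFactor]

theorem embed_crankFactor {n : ℕ} (hn : 1 ≤ n) :
    embed (crankFactor ℤ n) = crankFactor ℤ[T;T⁻¹] n := by
  have h0 : 2 * n ≠ 0 := by omega
  rw [crankFactor, crankFactor, embed, map_mul, map_qInv _ (by simp [h0])]
  simp

theorem embed_overlineFactor (n : ℕ) :
    embed (overlineFactor ℤ n) = overlineFactor ℤ[T;T⁻¹] n := by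
  rw [overlineFactor, overlineFactor, embed, map_mul,
    map_qInv _ (by simp [constantCoeff_qPochInf]), map_qPochInf, map_qPochInf]
  simp

theorem agreeBelow_crankFactor {R : Type*} [CommRing R] {i n : ℕ} (h : i ≤ n) :
    AgreeBelow i (crankFactor R n) 0 :=
  AgreeBelow.X_pow_mul _ (by omega)

/-- The coefficient of `(z - 2 + z⁻¹) ^ k` in `crankTail`. -/
def symmTail (k n : ℕ) : ℤ⟦X⟧ :=
  symmMap k (crankTail (LaurentPolynomial.T 1) (LaurentPolynomial.T (-1)) n)

theorem crankTail_sub_succ' {n : ℕ} (hn : 1 ≤ n) :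
    crankTail (LaurentPolynomial.T 1 : ℤ[T;T⁻¹]) (LaurentPolynomial.T (-1)) n -
      crankTail (LaurentPolynomial.T 1) (LaurentPolynomial.T (-1)) (n + 1) =
    C symmVar * (embed (crankFactor ℤ n) *
      crankTail (LaurentPolynomial.T 1) (LaurentPolynomial.T (-1)) n) := by
  rw [crankTail_sub_succ _ _ T_one_mul_T_neg_one hn, embed_crankFactor hn, symmVar]

theorem symmTail_sub_succ (k : ℕ) {n : ℕ} (hn : 1 ≤ n) :
    symmTail (k + 1) n - symmTail (k + 1) (n + 1) = crankFactor ℤ n * symmTail k n := by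
  rw [symmTail, symmTail, ← map_sub, crankTail_sub_succ' hn, symmMap_succ_symmVar_mul,
    symmMap_embed_mul, symmTail]

/-- At z = 1 every factor of `crankTail` is 1. Formally, the differences in n vanish and the limit
is 1. -/
theorem symmTail_zero {n : ℕ} (hn : 1 ≤ n) : symmTail 0 n = 1 := by
  have h : ∀ j, symmTail 0 n = symmTail 0 (n + j) := by
    intro j
    induction j with
    | zero => rfl
    | succ j ih =>
      rw [ih, ← sub_eq_zero, ← add_assoc, symmTail, symmTail, ← map_sub,
        crankTail_sub_succ' (by omega), symmMap_zero_symmVar_mul]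
  refine AgreeBelow.eq fun N => ?_
  rw [h N]
  have := ((agreeBelow_crankTail (LaurentPolynomial.T 1 : ℤ[T;T⁻¹])
    (LaurentPolynomial.T (-1)) (n + N)).mono (show N ≤ n + N by omega)).symmMap 0
  rwa [symmMap_one, if_pos rfl] at this

theorem agreeBelow_crankFactor_mul_symmTail (k n i : ℕ) :
    AgreeBelow i (crankFactor ℤ (n + i) * symmTail k (n + i)) 0 :=
  (agreeBelow_crankFactor (by omega)).mul_zero_left _

/-- Telescoping `symmTail_sub_succ` to infinity; the boundary term vanishes because `crankTail`
tends to 1 and `symmCoeff (k + 1)` kills 1. -/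
theorem symmTail_succ (k : ℕ) {n : ℕ} (hn : 1 ≤ n) : symmTail (k + 1) n =
    formalSum fun i => crankFactor ℤ (n + i) * symmTail k (n + i) := by
  refine (formalSum_eq (agreeBelow_crankFactor_mul_symmTail k n) fun N => ?_).symm
  have h : ∑ i ∈ range N, crankFactor ℤ (n + i) * symmTail k (n + i) =
      symmTail (k + 1) n - symmTail (k + 1) (n + N) := by
    rw [sum_congr rfl fun i _ => (symmTail_sub_succ k (show 1 ≤ n + i by omega)).symm]
    exact sum_range_sub' (fun i => symmTail (k + 1) (n + i)) N
  rw [h]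
  have := ((agreeBelow_crankTail (LaurentPolynomial.T 1 : ℤ[T;T⁻¹])
    (LaurentPolynomial.T (-1)) (n + N)).mono (show N ≤ n + N by omega)).symmMap (k + 1)
  rw [symmMap_one, if_neg (by omega), ← symmTail] at this
  simpa using (AgreeBelow.refl (symmTail (k + 1) n)).sub this

theorem symmMap_crankGF_sub_rankGF (k : ℕ) : symmMap (k + 1) crankGF -
    symmMap (k + 1) (rankGF (LaurentPolynomial.T 1) (LaurentPolynomial.T (-1))) =
    formalSum fun i => overlineFactor ℤ (1 + i) *
      (crankFactor ℤ (1 + i) * symmTail k (1 + i)) := by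
  set z : ℤ[T;T⁻¹] := LaurentPolynomial.T 1
  set w : ℤ[T;T⁻¹] := LaurentPolynomial.T (-1)
  have hz : z * w = 1 := T_one_mul_T_neg_one
  have h₀ : kTerm z w 0 0 = 1 := by simp [kTerm]
  have h₁ : rankGF z w = crankGF + formalSum fun i => tailFactor z w 0 * kTerm z w 0 (i + 1) := by
    rw [rankGF_eq z w hz, kSum, formalSum_succ (agreeBelow_kTerm z w 0), h₀, mul_add, mul_one,
      crankGF_eq, mul_formalSum fun i => (agreeBelow_kTerm z w 0 (i + 1)).mono (Nat.le_succ i)]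
  have h₂ : ∀ i, symmMap (k + 1) (tailFactor z w 0 * kTerm z w 0 (i + 1)) =
      -(overlineFactor ℤ (1 + i) * (crankFactor ℤ (1 + i) * symmTail k (1 + i))) := fun i => by
    rw [tailFactor_zero_mul_kTerm z w hz, map_neg, ← embed_crankFactor (by omega),
      ← embed_overlineFactor, ← map_mul, show z - 2 + w = symmVar from rfl,
      symmMap_succ_symmVar_mul, symmMap_embed_mul, add_comm i 1, mul_assoc]
    rfl
  rw [h₁, map_add, symmMap_formalSum]
  simp_rw [h₂]
  ext n
  simp [formalSum]

/-! ### Sums over monotone tuples -/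

/-- The monotone `k`-tuples of integers that are at least `n`. -/
abbrev MonotoneTuple (k n : ℕ) := {v : Fin k → ℕ // Monotone v ∧ ∀ i, n ≤ v i}

theorem monotone_cons {k n : ℕ} (v : MonotoneTuple k n) :
    Monotone (Fin.cons n v.1 : Fin (k + 1) → ℕ) := by
  intro i j hij
  induction i using Fin.cases with
  | zero =>
    induction j using Fin.cases with
    | zero => rfl
    | succ j => simpa using v.2.2 j
  | succ i =>
    induction j using Fin.cases with
    | zero => exact absurd hij (by simp)
    | succ j => simpa using v.2.1 (by simpa using hij)

/-- Prepending an entry to a monotone tuple. -/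
def consTuple (k n : ℕ) (x : Σ j : ℕ, MonotoneTuple k (n + j)) : MonotoneTuple (k + 1) n :=
  ⟨Fin.cons (n + x.1) x.2.1, monotone_cons x.2, fun i => by
    induction i using Fin.cases with
    | zero => simp
    | succ i =>
      have := x.2.2.2 i
      rw [Fin.cons_succ]
      omega⟩

theorem consTuple_bijective (k n : ℕ) : Function.Bijective (consTuple k n) := by
  constructor
  · rintro ⟨j, v⟩ ⟨j', v'⟩ h
    have h' : (Fin.cons (n + j) v.1 : Fin (k + 1) → ℕ) = Fin.cons (n + j') v'.1 :=
      congrArg Subtype.val h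
    obtain ⟨h₁, h₂⟩ := Fin.cons_injective2 h'
    obtain rfl : j = j' := by omega
    rw [Subtype.ext h₂]
  · intro v
    have h₀ : n + (v.1 0 - n) = v.1 0 := Nat.add_sub_of_le (v.2.2 0)
    refine ⟨⟨v.1 0 - n, ⟨Fin.tail v.1, fun i j hij => v.2.1 (by simpa using hij), fun i => ?_⟩⟩,
      Subtype.ext ?_⟩
    · rw [h₀]
      exact v.2.1 (Fin.zero_le _)
    · change (Fin.cons (n + (v.1 0 - n)) (Fin.tail v.1) : Fin (k + 1) → ℕ) = v.1
      rw [h₀, Fin.cons_self_tail]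

/-- Only the finitely many tuples with all entries at most n affect the coefficient of q^n. -/
theorem summable_of_agreeBelow {k : ℕ} {p : (Fin k → ℕ) → Prop} {f : {v // p v} → ℤ⟦X⟧}
    (h : ∀ v i, AgreeBelow (v.1 i) (f v) 0) : Summable f := by
  rw [PowerSeries.WithPiTopology.summable_iff_summable_coeff]
  intro n
  refine summable_of_hasFiniteSupport ?_
  refine Set.Finite.subset ((Set.finite_Iic (fun _ : Fin k => n)).preimage
    Subtype.val_injective.injOn) fun v hv => ?_
  rw [Set.mem_preimage, Set.mem_Iic]
  intro i
  by_contra hc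
  rw [not_le] at hc
  exact hv (by simpa using h v i n hc)

theorem agreeBelow_prod_crankFactor {k : ℕ} (v : Fin k → ℕ) (i : Fin k) :
    AgreeBelow (v i) (∏ i, crankFactor ℤ (v i)) 0 := by
  rw [← mul_prod_erase univ _ (mem_univ i)]
  exact (agreeBelow_crankFactor le_rfl).mul_zero_left _

/-- Summation over the smallest entry is made outermost. The weight `b` on that entry is 1 in the
recursion for `symmTail` and `overlineFactor` in the final formula. -/
theorem hasSum_cons {k n : ℕ} {P : ℕ → ℤ⟦X⟧}
    (hP : ∀ m, n ≤ m → HasSum (fun v : MonotoneTuple k m => ∏ i, crankFactor ℤ (v.1 i)) (P m))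
    (b : ℕ → ℤ⟦X⟧) :
    HasSum (fun v : MonotoneTuple (k + 1) n => b (v.1 0) * ∏ i, crankFactor ℤ (v.1 i))
      (formalSum fun i => b (n + i) * (crankFactor ℤ (n + i) * P (n + i))) := by
  rw [← (Equiv.ofBijective _ (consTuple_bijective k n)).hasSum_iff]
  refine HasSum.sigma_of_hasSum (g := fun i => b (n + i) * (crankFactor ℤ (n + i) * P (n + i)))
    (hasSum_formalSum fun i => ((agreeBelow_crankFactor (by omega)).mul_zero_left _).mul_zero_right _)
    (fun j => ?_) ?_
  · have h := ((hP (n + j) (by omega)).mul_left (crankFactor ℤ (n + j))).mul_left (b (n + j))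
    convert! h using 2 with v
    simp only [Function.comp_apply, Equiv.ofBijective_apply, consTuple, Fin.prod_univ_succ,
      Fin.cons_zero, Fin.cons_succ]
  · refine (Equiv.summable_iff _).mpr (summable_of_agreeBelow fun v i => ?_)
    exact (agreeBelow_prod_crankFactor v.1 i).mul_zero_right _

theorem hasSum_symmTail (k : ℕ) : ∀ n, 1 ≤ n →
    HasSum (fun v : MonotoneTuple k n => ∏ i, crankFactor ℤ (v.1 i)) (symmTail k n) := by
  induction k with
  | zero =>
    intro n hn
    rw [symmTail_zero hn]
    have : Unique (MonotoneTuple 0 n) :=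
      { default := ⟨Fin.elim0, fun i => i.elim0, fun i => i.elim0⟩
        uniq := fun v => Subtype.ext (Subsingleton.elim _ _) }
    simp
  | succ k ih =>
    intro n hn
    rw [symmTail_succ k hn]
    simpa using hasSum_cons (fun m hm => ih m (hn.trans hm)) 1

theorem qInv_prod {ι R : Type*} [CommRing R] (s : Finset ι) (f : ι → R⟦X⟧)
    (hf : ∀ i ∈ s, constantCoeff (f i) = 1) : qInv (∏ i ∈ s, f i) = ∏ i ∈ s, qInv (f i) := by
  refine qInv_unique ?_ ?_
  · rw [map_prod]
    exact prod_eq_one hf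
  · rw [← prod_mul_distrib]
    exact prod_eq_one fun i hi => mul_qInv _ (hf i hi)

theorem summand_eq (k : ℕ) (v : Fin (k + 1) → ℕ) (hv : ∀ i, 1 ≤ v i) :
    summand (k + 1) (Nat.succ_pos k) v =
      overlineFactor ℤ (v 0) * ∏ i, crankFactor ℤ (v i) := by
  have h : ∀ i ∈ univ, constantCoeff ((1 - X ^ (2 * v i)) ^ 2 : ℤ⟦X⟧) = 1 := fun i _ => by
    have : 2 * v i ≠ 0 := by have := hv i; omega
    simp [show v i ≠ 0 by omega]
  rw [summand, qInv_prod _ _ h, mul_sum, ← prod_pow_eq_pow_sum, ← prod_mul_distrib, mul_comm]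
  rfl

theorem coeff_symmMap_sub (k n : ℕ) : coeff n (symmMap k crankGF -
    symmMap k (rankGF (LaurentPolynomial.T 1) (LaurentPolynomial.T (-1)))) = sptBarTwo k n := by
  rw [map_sub, ← mu2bar_eq, ← eta2bar_eq, sptBarTwo]

theorem hasSum_summand (k : ℕ) : HasSum (fun v : MonotoneTuple (k + 1) 1 =>
    summand (k + 1) (Nat.succ_pos k) v.1)
    (PowerSeries.mk fun n => if n = 0 then 0 else sptBarTwo (k + 1) n) := by
  have h₁ : (PowerSeries.mk fun n => if n = 0 then 0 else sptBarTwo (k + 1) n) =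
      formalSum fun i => overlineFactor ℤ (1 + i) *
        (crankFactor ℤ (1 + i) * symmTail k (1 + i)) := by
    ext n
    rw [coeff_mk]
    split_ifs with h
    · subst h
      simp [formalSum, crankFactor]
    · rw [← symmMap_crankGF_sub_rankGF, coeff_symmMap_sub]
  rw [h₁]
  rw [funext fun v : MonotoneTuple (k + 1) 1 => summand_eq k v.1 v.2.2]
  exact hasSum_cons (hasSum_symmTail k) (overlineFactor ℤ)

/-! ### Nonnegativity -/

/-- All coefficients are nonnegative. -/
def CoeffNonneg (f : ℤ⟦X⟧) : Prop := ∀ n, 0 ≤ coeff n f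

namespace CoeffNonneg

variable {f g : ℤ⟦X⟧}

theorem one : CoeffNonneg 1 := fun n => by
  rw [coeff_one]
  split_ifs <;> simp

theorem X_pow (m : ℕ) : CoeffNonneg (X ^ m) := fun n => by
  rw [coeff_X_pow]
  split_ifs <;> simp

theorem add (hf : CoeffNonneg f) (hg : CoeffNonneg g) : CoeffNonneg (f + g) := fun n => by
  rw [map_add]
  exact add_nonneg (hf n) (hg n)

theorem mul (hf : CoeffNonneg f) (hg : CoeffNonneg g) : CoeffNonneg (f * g) := fun n => by
  rw [coeff_mul]
  exact sum_nonneg fun p _ => mul_nonneg (hf _) (hg _)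

theorem prod {ι : Type*} (s : Finset ι) {f : ι → ℤ⟦X⟧} (h : ∀ i ∈ s, CoeffNonneg (f i)) :
    CoeffNonneg (∏ i ∈ s, f i) :=
  prod_induction _ _ (fun _ _ => mul) one h

/-- Induction on the coefficient index through 1/(1-q^m) = 1 + q^m/(1-q^m). -/
theorem qInv_one_sub_X_pow {m : ℕ} (hm : m ≠ 0) : CoeffNonneg (qInv (1 - X ^ m)) := fun n => by
  have h : qInv (1 - X ^ m : ℤ⟦X⟧) = 1 + qInv (1 - X ^ m) * X ^ m := by
    have := mul_qInv (1 - X ^ m : ℤ⟦X⟧) (by simp [hm])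
    linear_combination this
  induction n using Nat.strong_induction_on with
  | _ n ih =>
    rw [h, map_add, coeff_mul_X_pow']
    refine add_nonneg (one n) ?_
    split_ifs with hmn
    · exact ih _ (by omega)
    · exact le_rfl

theorem crankFactor {n : ℕ} (hn : 1 ≤ n) : CoeffNonneg (crankFactor ℤ n) := by
  have h0 : 2 * n ≠ 0 := by omega
  have hc : constantCoeff (1 - X ^ (2 * n) : ℤ⟦X⟧) = 1 := by simp [show n ≠ 0 by omega]
  rw [SptBar.crankFactor, sq, qInv_mul hc hc]
  exact (X_pow _).mul ((qInv_one_sub_X_pow h0).mul (qInv_one_sub_X_pow h0))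

theorem overlineFactor (n : ℕ) : CoeffNonneg (overlineFactor ℤ n) := by
  refine mul (fun m => ?_) fun m => ?_
  · rw [agreeBelow_qPochInf _ le_rfl le_rfl m (Nat.lt_succ_self m)]
    refine prod _ (fun j _ => ?_) m
    rw [neg_mul, sub_neg_eq_add, ← pow_add]
    exact one.add (X_pow _)
  · rw [AgreeBelow.qInv (by simp [constantCoeff_qPochInf]) (by simp [constantCoeff_qPoch])
      (agreeBelow_qPochInf _ le_rfl le_rfl) m (Nat.lt_succ_self m), qPoch,
      qInv_prod _ _ (by simp)]
    refine prod _ (fun j _ => ?_) m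
    rw [← pow_add]
    exact qInv_one_sub_X_pow (by omega)

end CoeffNonneg

theorem sptBarTwo_nonneg (k n : ℕ) (hn : 1 ≤ n) : 0 ≤ sptBarTwo (k + 1) n := by
  have h := (PowerSeries.WithPiTopology.hasSum_iff_hasSum_coeff ℤ).mp (hasSum_summand k) n
  rw [coeff_mk, if_neg (by omega)] at h
  refine h.nonneg fun v => ?_
  rw [summand_eq k v.1 v.2.2]
  exact (CoeffNonneg.overlineFactor _).mul
    (CoeffNonneg.prod _ fun i _ => CoeffNonneg.crankFactor (v.2.2 i)) n

end SptBar

end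

theorem mainTheorem4 (k : ℕ) (hk : 1 ≤ k) :
    HasSum
      (fun v : {v : Fin k → ℕ // Monotone v ∧ ∀ i, 1 ≤ v i} => SptBar.summand k hk v.1)
      (PowerSeries.mk fun n => if n = 0 then 0 else SptBar.sptBarTwo k n) ∧
    ∀ n : ℕ, 1 ≤ n → 0 ≤ SptBar.sptBarTwo k n := by
  obtain ⟨k, rfl⟩ := Nat.exists_eq_add_of_le' hk
  exact ⟨SptBar.hasSum_summand k, fun n hn => SptBar.sptBarTwo_nonneg k n hn⟩
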